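/- Let $d\in\{2,3\}$ and let $\Omega\subset\mathbb{R}^d$ be a bounded Lipschitz domain, i.e. a bounded open set (connectedness is not needed) that near each boundary point lies strictly on one side of the graph of a Lipschitz function in suitable orthogonal coordinates. Let $D_1,D_2,\Sigma_{a1},\Sigma_{a2},\Sigma_{1\to2}>0$, $\alpha_1,\alpha_2\ge 0$ and $\nu_1,\nu_2,\Sigma_{f1},\Sigma_{f2}\in\mathbb{R}$ be constants. Let $V=H^1(\Omega,\mathbb{C})\times H^1(\Omega,\mathbb{C})$ with its usual Hilbert norm, and define on $V$ the sesquilinear forms $$ \begin{aligned} a((\phi_1,\phi_2),(v_1,v_2))={}&\int_\Omega D_1\nabla\phi_1\cdot\nabla\overline{v_1}+(\Sigma_{a1}+\Sigma_{1\to2})\,\phi_1\overline{v_1}\,dx\\ &+\int_\Omega D_2\nabla\phi_2\cdot\nabla\overline{v_2}+\Sigma_{a2}\,\phi_2\overline{v_2}-\Sigma_{1\to2}\,\phi_1\overline{v_2}\,dx +\int_{\partial\Omega}\alpha_1\phi_1\overline{v_1}+\alpha_2\phi_2\overline{v_2}\,dS,\\ b((f_1,f_2),(v_1,v_2))={}&\int_\Omega(\nu_1\Sigma_{f1}f_1+\nu_2\Sigma_{f2}f_2)\,\overline{v_1}\,dx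 , \end{aligned} $$ where the boundary values are traces: the trace of $u\in H^1(\Omega,\mathbb{C})$ is the $\gamma\in L^2(\partial\Omega,\mathbb{C})$ for which there are functions in $C_c^\infty(\mathbb{R}^d,\mathbb{C})$ that converge to $u$ in $H^1(\Omega,\mathbb{C})$ and whose restrictions to $\partial\Omega$ converge to $\gamma$ in $L^2(\partial\Omega,\mathbb{C})$. Then: 1. Every $u\in H^1(\Omega,\mathbb{C})$ has exactly one trace, so that $a$ is well defined. For every $F\in V$ there is exactly one $\Phi\in V$ with $a(\Phi,v)=b(F,v)$ for all $v\in V$. The solution operator $T:V\to V$, $TF=\Phi$, is thus well defined; it is linear, bounded and compact. 2. For every $F\in V$ there is exactly one $\Phi^*\in V$ with $a(v,\Phi^*)=b(v,F)$ for all $v\in V$. The adjoint solution operator $T^*:V\to V$, $T^*F=\Phi^*$, is thus well defined; it is linear, bounded and compact. -/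

import Mathlib

open MeasureTheory Filter
open scoped Topology ContDiff InnerProductSpace

namespace TwoGroup

noncomputable section

/-- The Euclidean space `ℝ^d`. -/
abbrev Space (d : ℕ) : Type := EuclideanSpace ℝ (Fin d)

/-- Bounded Lipschitz domain: a bounded open set which, near each of its boundary points, lies
strictly above the graph of a Lipschitz function, in some orthogonal coordinate system whose
vertical axis is the unit vector `n`; the horizontal variable is the component of `y` in the
hyperplane orthogonal to `n`. (Connectedness is not imposed, so connected domains are a
special case.) -/
def IsBoundedLipschitzDomain {d : ℕ} (Ω : Set (Space d)) : Prop :=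
  IsOpen Ω ∧ Bornology.IsBounded Ω ∧
    ∀ x ∈ frontier Ω, ∃ r : ℝ, 0 < r ∧ ∃ n : Space d, ‖n‖ = 1 ∧
      ∃ (g : ((ℝ ∙ n)ᗮ : Submodule ℝ (Space d)) → ℝ) (K : NNReal), LipschitzWith K g ∧
        ∀ y ∈ Metric.ball x r,
          (y ∈ Ω ↔ g ((ℝ ∙ n)ᗮ.orthogonalProjectionOnto y) < ⟪n, y⟫_ℝ)

/-- Lebesgue measure on `Ω`. -/
abbrev vol {d : ℕ} (Ω : Set (Space d)) : Measure (Space d) := volume.restrict Ω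

/-- Surface measure on the boundary of `Ω`: the `(d-1)`-dimensional Hausdorff measure, in its
Euclidean normalization (length for `d = 2`, area for `d = 3`). -/
abbrev surf {d : ℕ} (Ω : Set (Space d)) : Measure (Space d) :=
  (μHE[d - 1]).restrict (frontier Ω)

/-- The partial derivative `∂φ/∂x_i`. -/
def pderiv {d : ℕ} {F : Type*} [NormedAddCommGroup F] [NormedSpace ℝ F]
    (i : Fin d) (φ : Space d → F) (x : Space d) : F :=
  fderiv ℝ φ x (EuclideanSpace.single i 1)

/-- Real test functions on `Ω`: smooth, with compact support contained in `Ω`. -/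
def IsTestFunction {d : ℕ} (Ω : Set (Space d)) (φ : Space d → ℝ) : Prop :=
  ContDiff ℝ ∞ φ ∧ HasCompactSupport φ ∧ tsupport φ ⊆ Ω

/-- `G` is the weak gradient of `u` on `Ω`. -/
def IsWeakGradient {d : ℕ} (Ω : Set (Space d)) (u : Space d → ℂ)
    (G : Space d → EuclideanSpace ℂ (Fin d)) : Prop :=
  ∀ φ : Space d → ℝ, IsTestFunction Ω φ → ∀ i : Fin d,
    ∫ x, pderiv i φ x • u x ∂(vol Ω) = - ∫ x, φ x • G x i ∂(vol Ω)

theorem IsTestFunction.memLp {d : ℕ} {Ω : Set (Space d)} {φ : Space d → ℝ}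
    (hφ : IsTestFunction Ω φ) : MemLp φ 2 (vol Ω) :=
  (hφ.1.continuous.memLp_of_hasCompactSupport hφ.2.1).restrict Ω

theorem IsTestFunction.memLp_pderiv {d : ℕ} {Ω : Set (Space d)} {φ : Space d → ℝ}
    (hφ : IsTestFunction Ω φ) (i : Fin d) : MemLp (pderiv i φ) 2 (vol Ω) := by
  have hc : Continuous (pderiv i φ) :=
    (hφ.1.continuous_fderiv (by simp)).clm_apply continuous_const
  have hs : HasCompactSupport (pderiv i φ) := hφ.2.1.fderiv_apply ℝ _
  exact (hc.memLp_of_hasCompactSupport hs).restrict Ω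

theorem memLp_coord {d : ℕ} {μ : Measure (Space d)} {G : Space d → EuclideanSpace ℂ (Fin d)}
    (hG : MemLp G 2 μ) (i : Fin d) : MemLp (fun x => G x i) 2 μ :=
  (EuclideanSpace.proj (𝕜 := ℂ) i : EuclideanSpace ℂ (Fin d) →L[ℂ] ℂ).comp_memLp' hG

/-- The Sobolev space `H¹(Ω, ℂ)`: the pairs `(u, G)` in `L²(Ω, ℂ) × L²(Ω, ℂ^d)` for which `G` is
the weak gradient of `u`. As `u` determines `G`, these pairs are the functions `u` in `L²` with weak
gradient in `L²`; the inner product inherited from the product is the usual `H¹` inner product. -/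
def H1 {d : ℕ} (Ω : Set (Space d)) :
    Submodule ℂ (WithLp 2 (Lp ℂ 2 (vol Ω) × Lp (EuclideanSpace ℂ (Fin d)) 2 (vol Ω))) where
  carrier := {p | IsWeakGradient Ω p.fst p.snd}
  zero_mem' := by
    intro φ hφ i
    have h1 : (fun x => pderiv i φ x •
        ((0 : WithLp 2 (Lp ℂ 2 (vol Ω) × Lp (EuclideanSpace ℂ (Fin d)) 2 (vol Ω))).fst
          : Space d → ℂ) x) =ᵐ[vol Ω] 0 := by
      filter_upwards [Lp.coeFn_zero ℂ 2 (vol Ω)] with x hx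
      simp only [WithLp.zero_fst, hx, Pi.zero_apply, smul_zero]
    have h2 : (fun x => φ x •
        ((0 : WithLp 2 (Lp ℂ 2 (vol Ω) × Lp (EuclideanSpace ℂ (Fin d)) 2 (vol Ω))).snd
          : Space d → EuclideanSpace ℂ (Fin d)) x i) =ᵐ[vol Ω] 0 := by
      filter_upwards [Lp.coeFn_zero (EuclideanSpace ℂ (Fin d)) 2 (vol Ω)] with x hx
      simp only [WithLp.zero_snd, hx, Pi.zero_apply, PiLp.zero_apply, smul_zero]
    rw [integral_congr_ae h1, integral_congr_ae h2]
    simp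
  add_mem' := by
    intro p q hp hq φ hφ i
    have h1 : (fun x => pderiv i φ x • ((p + q).fst : Space d → ℂ) x) =ᵐ[vol Ω]
        fun x => pderiv i φ x • p.fst x + pderiv i φ x • q.fst x := by
      filter_upwards [Lp.coeFn_add p.fst q.fst] with x hx
      simp only [WithLp.add_fst, hx, Pi.add_apply, smul_add]
    have h2 : (fun x => φ x • ((p + q).snd : Space d → EuclideanSpace ℂ (Fin d)) x i) =ᵐ[vol Ω]
        fun x => φ x • p.snd x i + φ x • q.snd x i := by
      filter_upwards [Lp.coeFn_add p.snd q.snd] with x hx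
      simp only [WithLp.add_snd, hx, Pi.add_apply, PiLp.add_apply, smul_add]
    have i1 : ∀ u : Lp ℂ 2 (vol Ω), Integrable (fun x => pderiv i φ x • u x) (vol Ω) := fun u =>
      memLp_one_iff_integrable.1 ((Lp.memLp u).smul (hφ.memLp_pderiv i))
    have i2 : ∀ G : Lp (EuclideanSpace ℂ (Fin d)) 2 (vol Ω),
        Integrable (fun x => φ x • G x i) (vol Ω) := fun G =>
      memLp_one_iff_integrable.1 ((memLp_coord (Lp.memLp G) i).smul hφ.memLp)
    rw [integral_congr_ae h1, integral_congr_ae h2, integral_add (i1 _) (i1 _),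
      integral_add (i2 _) (i2 _), hp φ hφ i, hq φ hφ i]
    ring
  smul_mem' := by
    intro c p hp φ hφ i
    have h1 : (fun x => pderiv i φ x • ((c • p).fst : Space d → ℂ) x) =ᵐ[vol Ω]
        fun x => c • (pderiv i φ x • p.fst x) := by
      filter_upwards [Lp.coeFn_smul c p.fst] with x hx
      simp only [WithLp.smul_fst, hx, Pi.smul_apply, smul_comm c]
    have h2 : (fun x => φ x • ((c • p).snd : Space d → EuclideanSpace ℂ (Fin d)) x i) =ᵐ[vol Ω]
        fun x => c • (φ x • p.snd x i) := by
      filter_upwards [Lp.coeFn_smul c p.snd] with x hx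
      simp only [WithLp.smul_snd, hx, Pi.smul_apply, PiLp.smul_apply, smul_comm c]
    rw [integral_congr_ae h1, integral_congr_ae h2, integral_smul, integral_smul, hp φ hφ i,
      smul_neg]

/-- The values of an element of `H¹(Ω, ℂ)`. -/
def val {d : ℕ} {Ω : Set (Space d)} (u : H1 Ω) : Space d → ℂ := u.1.fst

/-- The weak gradient of an element of `H¹(Ω, ℂ)`. -/
def grad {d : ℕ} {Ω : Set (Space d)} (u : H1 Ω) : Space d → EuclideanSpace ℂ (Fin d) := u.1.snd

/-- `γ` is a trace of `u` on the boundary: some sequence of functions in `C_c^∞(ℝ^d, ℂ)` converges to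
`u` in `H¹(Ω)` while its restrictions to the boundary converge to `γ` in `L²(∂Ω)`. -/
def IsTrace {d : ℕ} {Ω : Set (Space d)} (u : H1 Ω) (γ : Lp ℂ 2 (surf Ω)) : Prop :=
  ∃ φ : ℕ → Space d → ℂ,
    (∀ k, ContDiff ℝ ∞ (φ k) ∧ HasCompactSupport (φ k)) ∧
    Tendsto (fun k => eLpNorm (fun x => φ k x - val u x) 2 (vol Ω)) atTop (𝓝 0) ∧
    (∀ i, Tendsto (fun k => eLpNorm (fun x => pderiv i (φ k) x - grad u x i) 2 (vol Ω))
      atTop (𝓝 0)) ∧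
    Tendsto (fun k => eLpNorm (fun x => φ k x - γ x) 2 (surf Ω)) atTop (𝓝 0)

open Classical in
/-- The trace of `u` in `L²(∂Ω, ℂ)`, the continuous extension of the restriction of smooth functions
to the boundary. On a bounded Lipschitz domain it always exists and is unique; the value `0`
is used only if no trace exists. -/
def trace {d : ℕ} {Ω : Set (Space d)} (u : H1 Ω) : Lp ℂ 2 (surf Ω) :=
  if h : ∃ γ, IsTrace u γ then h.choose else 0

/-- The Hilbert space `V = H¹(Ω, ℂ) × H¹(Ω, ℂ)`. -/
abbrev V {d : ℕ} (Ω : Set (Space d)) : Type := WithLp 2 (H1 Ω × H1 Ω)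

/-- The constant coefficients of the two-group model: diffusion coefficients `D₁, D₂`, absorption
cross sections `Sa1, Sa2`, the scattering cross section `S12` from group 1 to group 2, neutron yields
`ν₁, ν₂`, fission cross sections `Sf1, Sf2`, and boundary coefficients `α₁, α₂`. -/
structure Coefficients where
  D₁ : ℝ
  D₂ : ℝ
  Sa1 : ℝ
  Sa2 : ℝ
  S12 : ℝ
  ν₁ : ℝ
  ν₂ : ℝ
  Sf1 : ℝ
  Sf2 : ℝ
  α₁ : ℝ
  α₂ : ℝ

open scoped ComplexConjugate

/-- The integral of `∇u · ∇(conj v)` over `Ω`. -/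
def gradForm {d : ℕ} {Ω : Set (Space d)} (u v : H1 Ω) : ℂ :=
  ∫ x, ∑ i, grad u x i * conj (grad v x i) ∂(vol Ω)

/-- The integral of `u (conj v)` over `Ω`. -/
def massForm {d : ℕ} {Ω : Set (Space d)} (u v : H1 Ω) : ℂ :=
  ∫ x, val u x * conj (val v x) ∂(vol Ω)

/-- The integral of `u (conj v)` over the boundary of `Ω`, with `u` and `v` in the sense of traces. -/
def bdryForm {d : ℕ} {Ω : Set (Space d)} (u v : H1 Ω) : ℂ :=
  ∫ x, trace u x * conj (trace v x) ∂(surf Ω)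

/-- The sesquilinear form `a` of the two-group problem. -/
def formA {d : ℕ} {Ω : Set (Space d)} (P : Coefficients) (Φ v : V Ω) : ℂ :=
  P.D₁ * gradForm Φ.fst v.fst + (P.Sa1 + P.S12) * massForm Φ.fst v.fst
    + P.D₂ * gradForm Φ.snd v.snd + P.Sa2 * massForm Φ.snd v.snd - P.S12 * massForm Φ.fst v.snd
    + P.α₁ * bdryForm Φ.fst v.fst + P.α₂ * bdryForm Φ.snd v.snd

/-- The sesquilinear form `b` of the two-group problem (the fission source). -/
def formB {d : ℕ} {Ω : Set (Space d)} (P : Coefficients) (F v : V Ω) : ℂ :=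
  P.ν₁ * P.Sf1 * massForm F.fst v.fst + P.ν₂ * P.Sf2 * massForm F.snd v.fst

/-- `Φ` solves the source problem with data `F`. -/
def IsSourceSolution {d : ℕ} {Ω : Set (Space d)} (P : Coefficients) (F Φ : V Ω) : Prop :=
  ∀ v : V Ω, formA P Φ v = formB P F v

/-- `Φ` solves the adjoint source problem with data `F`. -/
def IsAdjointSourceSolution {d : ℕ} {Ω : Set (Space d)} (P : Coefficients) (F Φ : V Ω) : Prop :=
  ∀ v : V Ω, formA P v Φ = formB P v F

end

end TwoGroup

open MeasureTheory Filter
open scoped Topology ContDiff InnerProductSpace ENNReal NNReal Convolution Manifold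

namespace TwoGroup

/-! The form `a` need not be coercive on `V`, because the scattering term may outweigh the
absorption. It is triangular, however: group 1 never sees group 2. Each diagonal block is a Robin
form `D (∇u,∇v) + S (u,v) + α (u,v)_∂Ω` with `D, S > 0` and `α ≥ 0`. Such a form is bounded once the
trace is bounded, and coercive with constant `min D S`, so it is represented by an invertible
operator on `H1 Ω` (`exists_robinOp`). Forward substitution solves the system and back substitution
its adjoint. The data enter only through the `L²` pairing, whose operator `massOp` is the adjoint of
the embedding into `L²` after the embedding itself. Rellich's theorem makes it compact, and hence
both solution operators.

What remains is Sobolev theory on a Lipschitz domain, all of it derived from one geometric fact: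
near each point of the closure, a fixed truncated cone placed at any point of `Ω` stays in `Ω`.
Density: a mollifier with support shifted along the cone samples a function only inside `Ω`, so it
commutes with the weak gradient up to the boundary (`exists_smooth_cut`); a partition of unity glues
the pieces. Traces: integrating along the vertical direction of a chart bounds the boundary `L²`
norm of a smooth function by its `H¹` norm (`exists_trace_le`); density then gives existence,
uniqueness and boundedness. Rellich: the same shifted mollification is close to the identity in
`L²`, uniformly on `H¹` balls, and it is controlled by its values on a finite net
(`exists_functionals`). The embedding is therefore a norm limit of finite rank operators
(`isCompactOperator_of_forall_exists`). -/

/-! ### Interior cones of Lipschitz domains -/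

/-- Uniform interior cone condition: from every point of `Ω ∩ U`, the truncated cone with axis `n`
and aperture `c` lies in `Ω`. -/
def IsConeNhd {d : ℕ} (Ω U : Set (Space d)) (n : Space d) (c : ℝ) : Prop :=
  ∀ y ∈ Ω ∩ U, ∀ t ∈ Set.Ioc (0 : ℝ) 1, Metric.closedBall (y + t • n) (t * c) ⊆ Ω

theorem exists_isConeNhd_of_mem {d : ℕ} {Ω : Set (Space d)} (hΩ : IsOpen Ω) {x : Space d}
    (hx : x ∈ Ω) : ∃ r > 0, ∃ (n : Space d) (c : ℝ), 0 < c ∧ IsConeNhd Ω (Metric.ball x r) n c := by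
  obtain ⟨r, hr, hrΩ⟩ := Metric.isOpen_iff.1 hΩ x hx
  -- At an interior point the axis may be zero: the cone degenerates to a ball.
  refine ⟨r / 2, by positivity, 0, r / 2, by positivity, ?_⟩
  intro y hy t ht p hp
  apply hrΩ
  have h1 := Metric.mem_ball.1 hy.2
  rw [smul_zero, add_zero, Metric.mem_closedBall] at hp
  have h2 : t * (r / 2) ≤ 1 * (r / 2) := by gcongr; exact ht.2
  rw [Metric.mem_ball]
  linarith [dist_triangle p y x]

theorem orthogonalProjectionOnto_smul_self {d : ℕ} (n : Space d) (t : ℝ) :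
    (ℝ ∙ n)ᗮ.orthogonalProjectionOnto (t • n) = 0 := by
  rw [map_smul, Submodule.orthogonalProjectionOnto_orthogonalComplement_singleton_eq_zero, smul_zero]

theorem inner_smul_self_of_norm_eq_one {d : ℕ} {n : Space d} (hn : ‖n‖ = 1) (t : ℝ) :
    ⟪n, t • n⟫_ℝ = t := by
  rw [inner_smul_right, real_inner_self_eq_norm_sq, hn]; ring

/-- Going up by `s` gains height `s`. A further displacement of size `s / (1 + K)` loses at most `s
/ (1 + K)` in height and raises the graph by at most `K s / (1 + K)`, together exactly `s`, so the
strict inequality at `y` survives. -/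
theorem exists_isConeNhd_of_chart {d : ℕ} {Ω : Set (Space d)} {x n : Space d} {r : ℝ} (hr : 0 < r)
    (hn : ‖n‖ = 1) {g : ((ℝ ∙ n)ᗮ : Submodule ℝ (Space d)) → ℝ} {K : ℝ≥0} (hg : LipschitzWith K g)
    (hΩ : ∀ y ∈ Metric.ball x r, (y ∈ Ω ↔ g ((ℝ ∙ n)ᗮ.orthogonalProjectionOnto y) < ⟪n, y⟫_ℝ)) :
    ∃ r > 0, ∃ (n : Space d) (c : ℝ), 0 < c ∧ IsConeNhd Ω (Metric.ball x r) n c := by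
  have hK : (0 : ℝ) < 1 + K := by positivity
  -- The radii add up to `r / 2 + r / 4 + r / 4 = r`, which keeps the cone inside the chart.
  refine ⟨r / 2, by positivity, (r / 4) • n, r / 4 / (1 + K), by positivity, ?_⟩
  rintro y ⟨hyΩ, hyU⟩ t ⟨ht0, ht1⟩ p hp
  rw [Metric.mem_ball] at hyU
  rw [Metric.mem_closedBall] at hp
  set s := t * (r / 4) with hs
  have hs0 : 0 < s := by positivity
  have hsr : s ≤ r / 4 := by nlinarith
  have hp' : dist p (y + s • n) ≤ s / (1 + K) := by
    rw [smul_smul] at hp; convert hp using 1; rw [hs]; ring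
  have hle : s / (1 + K) ≤ s := div_le_self hs0.le (by simp)
  have hpx : p ∈ Metric.ball x r := by
    rw [Metric.mem_ball]
    have h1 : dist (y + s • n) y = s := by
      rw [dist_eq_norm, add_sub_cancel_left, norm_smul, hn, mul_one, Real.norm_of_nonneg hs0.le]
    linarith [dist_triangle p (y + s • n) x, dist_triangle (y + s • n) y x]
  have hy := (hΩ y (by rw [Metric.mem_ball]; linarith)).1 hyΩ
  rw [hΩ p hpx]
  set q := p - (y + s • n) with hq
  have hqn : ‖q‖ ≤ s / (1 + K) := by rwa [hq, ← dist_eq_norm]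
  have hpq : p = y + s • n + q := by rw [hq]; abel
  have h1 : ⟪n, p⟫_ℝ ≥ ⟪n, y⟫_ℝ + s - s / (1 + K) := by
    rw [hpq, inner_add_right, inner_add_right, inner_smul_self_of_norm_eq_one hn]
    have := abs_le.1 ((abs_real_inner_le_norm n q).trans (by rw [hn, one_mul]))
    linarith [this.1]
  have h2 : g ((ℝ ∙ n)ᗮ.orthogonalProjectionOnto p) ≤
      g ((ℝ ∙ n)ᗮ.orthogonalProjectionOnto y) + K * (s / (1 + K)) := by
    have h3 := hg.dist_le_mul ((ℝ ∙ n)ᗮ.orthogonalProjectionOnto p)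
      ((ℝ ∙ n)ᗮ.orthogonalProjectionOnto y)
    have h4 : (ℝ ∙ n)ᗮ.orthogonalProjectionOnto p - (ℝ ∙ n)ᗮ.orthogonalProjectionOnto y =
        (ℝ ∙ n)ᗮ.orthogonalProjectionOnto q := by
      rw [hpq, map_add, map_add, orthogonalProjectionOnto_smul_self]; abel
    rw [dist_eq_norm _ ((ℝ ∙ n)ᗮ.orthogonalProjectionOnto y), h4, Real.dist_eq] at h3
    have h5 := (ℝ ∙ n)ᗮ.norm_orthogonalProjectionOnto_apply_le q
    have h6 : (K : ℝ) * ‖(ℝ ∙ n)ᗮ.orthogonalProjectionOnto q‖ ≤ K * (s / (1 + K)) := by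
      gcongr; exact h5.trans hqn
    linarith [(abs_le.1 h3).2]
  have h3 : s / (1 + K) + K * (s / (1 + K)) = s := by field_simp
  linarith

theorem IsBoundedLipschitzDomain.exists_isConeNhd {d : ℕ} {Ω : Set (Space d)}
    (hΩ : IsBoundedLipschitzDomain Ω) {x : Space d} (hx : x ∈ closure Ω) :
    ∃ r > 0, ∃ (n : Space d) (c : ℝ), 0 < c ∧ IsConeNhd Ω (Metric.ball x r) n c := by
  by_cases h : x ∈ Ω
  · exact exists_isConeNhd_of_mem hΩ.1 h
  · obtain ⟨r, hr, n, hn, g, K, hg, hU⟩ := hΩ.2.2 x ⟨hx, by rwa [hΩ.1.interior_eq]⟩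
    exact exists_isConeNhd_of_chart hr hn hg hU

/-- A bounded Lipschitz domain is covered by finitely many balls with the cone condition. -/
theorem IsBoundedLipschitzDomain.exists_finite_cover {d : ℕ} {Ω : Set (Space d)}
    (hΩ : IsBoundedLipschitzDomain Ω) :
    ∃ (ι : Type) (_ : Fintype ι) (x : ι → Space d) (r : ι → ℝ) (n : ι → Space d) (c : ι → ℝ),
      (∀ j, 0 < c j ∧ IsConeNhd Ω (Metric.ball (x j) (r j)) (n j) (c j)) ∧
      closure Ω ⊆ ⋃ j, Metric.ball (x j) (r j) := by
  have hc : IsCompact (closure Ω) := hΩ.2.1.isCompact_closure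
  have h : ∀ x : closure Ω, ∃ r > 0, ∃ (n : Space d) (c : ℝ),
      0 < c ∧ IsConeNhd Ω (Metric.ball (x : Space d) r) n c := fun x => hΩ.exists_isConeNhd x.2
  choose r hr n c hcn using h
  obtain ⟨t, ht⟩ := hc.elim_finite_subcover (fun x : closure Ω => Metric.ball (x : Space d) (r x))
    (fun _ => Metric.isOpen_ball)
    (fun y hy => Set.mem_iUnion.2 ⟨⟨y, hy⟩, Metric.mem_ball_self (hr _)⟩)
  let e := t.equivFin.symm
  refine ⟨Fin t.card, inferInstance, fun j => (e j).1, fun j => r (e j), fun j => n (e j),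
    fun j => c (e j), fun j => hcn _, fun y hy => ?_⟩
  obtain ⟨j, hj, hyj⟩ := Set.mem_iUnion₂.1 (ht hy)
  refine Set.mem_iUnion.2 ⟨e.symm ⟨j, hj⟩, ?_⟩
  simpa using hyj

/-! ### Jensen inequalities in L² -/

section L2

variable {α β E : Type*} [MeasurableSpace α] [MeasurableSpace β] [NormedAddCommGroup E]

theorem eLpNorm_two_sq (f : α → E) (μ : Measure α) :
    eLpNorm f 2 μ ^ 2 = ∫⁻ x, ‖f x‖ₑ ^ 2 ∂μ := by
  have := eLpNorm_nnreal_pow_eq_lintegral (f := f) (μ := μ) (p := 2) (by norm_num)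
  simpa using this

theorem eLpNorm_two_le_iff (f : α → E) (μ : Measure α) (C : ℝ≥0∞) :
    eLpNorm f 2 μ ≤ C ↔ ∫⁻ x, ‖f x‖ₑ ^ 2 ∂μ ≤ C ^ 2 := by
  rw [← eLpNorm_two_sq, ENNReal.pow_le_pow_left_iff (by norm_num)]

theorem lintegral_sq_le (μ : Measure α) [IsProbabilityMeasure μ] {h : α → ℝ≥0∞}
    (hh : AEMeasurable h μ) : (∫⁻ x, h x ∂μ) ^ 2 ≤ ∫⁻ x, h x ^ 2 ∂μ := by
  have h1 := eLpNorm'_le_eLpNorm'_of_exponent_le (p := 1) (q := 2) (by norm_num) (by norm_num) μ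
    hh.aestronglyMeasurable
  simp only [eLpNorm', enorm_eq_self, ENNReal.rpow_one, div_one] at h1
  have h2 := pow_le_pow_left' h1 2
  rw [← ENNReal.rpow_natCast (_ ^ _), ← ENNReal.rpow_mul] at h2
  norm_num at h2
  exact h2

theorem enorm_integral_sq_le [NormedSpace ℝ E] (μ : Measure α) [IsProbabilityMeasure μ]
    (h : α → E) : ‖∫ x, h x ∂μ‖ₑ ^ 2 ≤ ∫⁻ x, ‖h x‖ₑ ^ 2 ∂μ := by
  by_cases hh : AEStronglyMeasurable h μ
  · exact (pow_le_pow_left' (enorm_integral_le_lintegral_enorm h) 2).trans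
      (lintegral_sq_le μ hh.enorm)
  -- Without measurability the integral takes the default value zero.
  · rw [integral_non_aestronglyMeasurable hh]; simp

/-- Jensen's inequality at each `y`, then Tonelli. Mollification is an average of translates, so
this reduces its error to that of single translations. -/
theorem lintegral_enorm_integral_sq_le [NormedSpace ℝ E] {μ : Measure α} [SFinite μ]
    {P : Measure β} [IsProbabilityMeasure P] {F : β → α → E}
    (hF : AEStronglyMeasurable (Function.uncurry F) (P.prod μ)) :
    ∫⁻ y, ‖∫ w, F w y ∂P‖ₑ ^ 2 ∂μ ≤ ∫⁻ w, ∫⁻ y, ‖F w y‖ₑ ^ 2 ∂μ ∂P := by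
  rw [lintegral_lintegral_swap (f := fun w y => ‖F w y‖ₑ ^ 2) (hF.enorm.pow_const 2)]
  exact lintegral_mono fun y => enorm_integral_sq_le P _

end L2

/-! ### Translations and mollification -/

section Translation

variable {d : ℕ} {E : Type*} [NormedAddCommGroup E]

theorem tendsto_eLpNorm_translate_sub {f : Space d → E} (hf : MemLp f 2 volume) :
    Tendsto (fun w => eLpNorm (fun y => f (y - w) - f y) 2 volume) (𝓝 0) (𝓝 0) := by
  have : Fact ((2 : ℝ≥0∞) ≠ ⊤) := ⟨by norm_num⟩
  have hc : Tendsto (fun w : Space d => DomAddAct.mk w +ᵥ hf.toLp f) (𝓝 0) (𝓝 (hf.toLp f)) := by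
    have : Continuous fun w : Space d => DomAddAct.mk w +ᵥ hf.toLp f :=
      DomAddAct.continuous_mk.vadd continuous_const
    have h0 := this.tendsto 0
    have h1 : (DomAddAct.mk (0 : Space d) +ᵥ hf.toLp f) = hf.toLp f := by
      rw [DomAddAct.mk_vadd_toLp]
      congr 1
      ext x; simp
    rwa [h1] at h0
  -- The action of `DomAddAct.mk w` adds `w` to the argument, hence the substitution of `-w`.
  have h2 := (tendsto_iff_edist_tendsto_0.1 (hc.comp (f := fun w : Space d => -w) (x := 𝓝 0)
    (by simpa using (continuous_neg (G := Space d)).tendsto 0)))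
  refine h2.congr fun w => ?_
  simp only [Function.comp_apply]
  rw [DomAddAct.mk_vadd_toLp, Lp.edist_toLp_toLp]
  congr 1
  ext y
  simp [sub_eq_neg_add]

end Translation

/-- A smooth mollifier supported in `S`. -/
structure IsMollifier {d : ℕ} (ρ : Space d → ℝ) (S : Set (Space d)) : Prop where
  contDiff : ContDiff ℝ ∞ ρ
  hasCompactSupport : HasCompactSupport ρ
  nonneg : ∀ w, 0 ≤ ρ w
  integral_eq_one : ∫ w, ρ w = 1
  tsupport_subset : tsupport ρ ⊆ S

theorem exists_isMollifier {d : ℕ} (n : Space d) {c : ℝ} (hc : 0 < c) :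
    ∃ ρ, IsMollifier ρ (Metric.closedBall n c) := by
  let b : ContDiffBump n := ⟨c / 2, c, by positivity, by linarith⟩
  exact ⟨b.normed volume, b.contDiff_normed, b.hasCompactSupport_normed, b.nonneg_normed,
    b.integral_normed, b.tsupport_normed_eq.subset⟩

section Mollify

variable {d : ℕ} {E : Type*} [NormedAddCommGroup E] [NormedSpace ℝ E]

/-- The mollification `ρ ⋆ f`. -/
noncomputable def mollify (ρ : Space d → ℝ) (f : Space d → E) : Space d → E :=
  ρ ⋆[ContinuousLinearMap.lsmul ℝ ℝ, volume] f

theorem mollify_apply (ρ : Space d → ℝ) (f : Space d → E) (y : Space d) :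
    mollify ρ f y = ∫ w, ρ w • f (y - w) := rfl

theorem mollify_apply' (ρ : Space d → ℝ) (f : Space d → E) (y : Space d) :
    mollify ρ f y = ∫ z, ρ (y - z) • f z := by
  rw [mollify_apply, ← integral_sub_left_eq_self _ volume y]
  simp

/-- The probability measure with density `ρ`. -/
noncomputable def mollMeasure (ρ : Space d → ℝ) : Measure (Space d) :=
  volume.withDensity fun w => ENNReal.ofReal (ρ w)

variable {ρ : Space d → ℝ} {S : Set (Space d)}

theorem IsMollifier.isProbabilityMeasure (hρ : IsMollifier ρ S) :
    IsProbabilityMeasure (mollMeasure ρ) := by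
  refine ⟨?_⟩
  rw [mollMeasure, withDensity_apply _ MeasurableSet.univ, Measure.restrict_univ,
    ← ofReal_integral_eq_lintegral_ofReal
      (hρ.contDiff.continuous.integrable_of_hasCompactSupport hρ.hasCompactSupport)
      (Eventually.of_forall hρ.nonneg), hρ.integral_eq_one, ENNReal.ofReal_one]

theorem IsMollifier.integral_mollMeasure (hρ : IsMollifier ρ S) (f : Space d → E) :
    ∫ w, f w ∂(mollMeasure ρ) = ∫ w, ρ w • f w := by
  rw [mollMeasure, integral_withDensity_eq_integral_toReal_smul
    hρ.contDiff.continuous.measurable.ennreal_ofReal (by simp)]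
  simp only [ENNReal.toReal_ofReal (hρ.nonneg _)]

theorem IsMollifier.ae_mem (hρ : IsMollifier ρ S) : ∀ᵐ w ∂(mollMeasure ρ), w ∈ S := by
  rw [mollMeasure, ae_withDensity_iff hρ.contDiff.continuous.measurable.ennreal_ofReal]
  refine Eventually.of_forall fun w hw => hρ.tsupport_subset (subset_tsupport _ ?_)
  intro h
  simp [h] at hw

theorem IsMollifier.integrable_smul (hρ : IsMollifier ρ S) {f : Space d → E}
    (hf : LocallyIntegrable f) (y : Space d) : Integrable fun w => ρ w • f (y - w) :=
  hρ.hasCompactSupport.convolutionExists_left (ContinuousLinearMap.lsmul ℝ ℝ)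
    hρ.contDiff.continuous hf y

theorem IsMollifier.mollify_sub (hρ : IsMollifier ρ S) {f : Space d → E}
    (hf : LocallyIntegrable f) (y : Space d) [CompleteSpace E] :
    mollify ρ f y - f y = ∫ w, (f (y - w) - f y) ∂(mollMeasure ρ) := by
  rw [hρ.integral_mollMeasure]
  simp only [smul_sub]
  rw [integral_sub (hρ.integrable_smul hf y)
    ((hρ.contDiff.continuous.integrable_of_hasCompactSupport hρ.hasCompactSupport).smul_const _),
    integral_smul_const, hρ.integral_eq_one, one_smul, mollify_apply]

/-- The error is the average of `f (y - w) - f y` over a probability measure carried by `S`. Only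
translations in `S` count, and only on `A`; this locality is what the cone condition can exploit. -/
theorem IsMollifier.lintegral_mollify_sub_le [CompleteSpace E] (hρ : IsMollifier ρ S)
    {f : Space d → E} (hf : LocallyIntegrable f) (hfm : StronglyMeasurable f) (A : Set (Space d))
    {C : ℝ≥0∞} (hC : ∀ w ∈ S, ∫⁻ y in A, ‖f (y - w) - f y‖ₑ ^ 2 ≤ C) :
    ∫⁻ y in A, ‖mollify ρ f y - f y‖ₑ ^ 2 ≤ C := by
  have := hρ.isProbabilityMeasure
  simp only [hρ.mollify_sub hf]
  refine (lintegral_enorm_integral_sq_le (F := fun w y => f (y - w) - f y) ?_).trans ?_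
  · refine StronglyMeasurable.aestronglyMeasurable ?_
    exact (hfm.comp_measurable (measurable_snd.sub measurable_fst)).sub
      (hfm.comp_measurable measurable_snd)
  · calc _ ≤ ∫⁻ _, C ∂(mollMeasure ρ) := lintegral_mono_ae (hρ.ae_mem.mono fun w hw => hC w hw)
      _ = C := by simp

/-- The support `S` need only lie near the origin, not contain it, so off-centre mollifiers are
covered. -/
theorem exists_delta_mollify_sub_le [CompleteSpace E] {f : Space d → E} (hf : MemLp f 2 volume)
    (hfm : StronglyMeasurable f) {ε : ℝ≥0∞} (hε : 0 < ε) :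
    ∃ δ > 0, ∀ (ρ : Space d → ℝ) (S : Set (Space d)), S ⊆ Metric.ball 0 δ → IsMollifier ρ S →
      eLpNorm (fun y => mollify ρ f y - f y) 2 volume ≤ ε := by
  obtain ⟨δ, hδ, h⟩ := Metric.eventually_nhds_iff_ball.1
    ((tendsto_eLpNorm_translate_sub hf).eventually (ge_mem_nhds hε))
  refine ⟨δ, hδ, fun ρ S hS hρ => ?_⟩
  rw [eLpNorm_two_le_iff, ← setLIntegral_univ]
  refine hρ.lintegral_mollify_sub_le (hf.locallyIntegrable (by norm_num)) hfm _ fun w hw => ?_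
  rw [setLIntegral_univ, ← eLpNorm_two_le_iff]
  exact h w (hS hw)

end Mollify

/-! ### Increments of smooth functions along segments -/

section Gradient

variable {d : ℕ}

/-- The classical gradient of a complex-valued function. -/
noncomputable def sgrad (φ : Space d → ℂ) (x : Space d) : EuclideanSpace ℂ (Fin d) :=
  WithLp.toLp 2 fun i => pderiv i φ x

theorem norm_fderiv_apply_le (φ : Space d → ℂ) (x v : Space d) :
    ‖fderiv ℝ φ x v‖ ≤ ‖v‖ * ‖sgrad φ x‖ := by
  have hv : v = ∑ i, v i • EuclideanSpace.single i (1 : ℝ) := by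
    ext j; simp [Finset.sum_apply, Pi.single_apply]
  have h1 : fderiv ℝ φ x v = ∑ i, v i • pderiv i φ x := by
    conv_lhs => rw [hv]
    rw [map_sum]
    simp only [map_smul, pderiv]
  rw [h1, EuclideanSpace.norm_eq, EuclideanSpace.norm_eq]
  refine (norm_sum_le _ _).trans ?_
  simp only [norm_smul]
  exact Real.sum_mul_le_sqrt_mul_sqrt _ _ _

theorem continuous_pderiv {F : Type*} [NormedAddCommGroup F] [NormedSpace ℝ F] {φ : Space d → F}
    (hφ : ContDiff ℝ ∞ φ) (i : Fin d) : Continuous (pderiv i φ) :=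
  (hφ.continuous_fderiv (by simp)).clm_apply continuous_const

theorem continuous_sgrad {φ : Space d → ℂ} (hφ : ContDiff ℝ ∞ φ) : Continuous (sgrad φ) :=
  (PiLp.continuous_toLp 2 _).comp (continuous_pi fun i => continuous_pderiv hφ i)

/-- Fundamental theorem of calculus and Jensen. Integrating up to `1` instead of `τ` makes the bound
independent of `τ`, so that it can be averaged over `τ`. -/
theorem enorm_sub_sq_le_lintegral_sgrad {φ : Space d → ℂ} (hφ : ContDiff ℝ ∞ φ) (y v : Space d)
    {τ : ℝ} (hτ : τ ∈ Set.Ioc (0 : ℝ) 1) :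
    ‖φ (y + τ • v) - φ y‖ₑ ^ 2 ≤
      ‖v‖ₑ ^ 2 * ∫⁻ s in Set.Ioc (0 : ℝ) 1, ‖sgrad φ (y + s • v)‖ₑ ^ 2 := by
  have hd : ∀ s : ℝ, HasDerivAt (fun s : ℝ => φ (y + s • v)) (fderiv ℝ φ (y + s • v) v) s := by
    intro s
    have h1 : HasDerivAt (fun s : ℝ => y + s • v) v s := by
      simpa using! ((hasDerivAt_id s).smul_const v).const_add y
    exact ((hφ.differentiable (by simp)) (y + s • v)).hasFDerivAt.comp_hasDerivAt s h1
  have hcont : Continuous fun s : ℝ => fderiv ℝ φ (y + s • v) v :=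
    ((hφ.continuous_fderiv (by simp)).comp (by fun_prop)).clm_apply continuous_const
  have hg : Continuous fun s : ℝ => ‖sgrad φ (y + s • v)‖ₑ :=
    ((continuous_sgrad hφ).comp (by fun_prop : Continuous fun s : ℝ => y + s • v)).enorm
  have h1 : φ (y + τ • v) - φ y = ∫ s in Set.Ioc (0 : ℝ) τ, fderiv ℝ φ (y + s • v) v := by
    rw [← intervalIntegral.integral_of_le hτ.1.le,
      intervalIntegral.integral_eq_sub_of_hasDerivAt (fun s _ => hd s)
        (hcont.intervalIntegrable _ _)]
    simp
  have : IsProbabilityMeasure (volume.restrict (Set.Ioc (0 : ℝ) 1)) := ⟨by simp⟩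
  have h2 : ‖φ (y + τ • v) - φ y‖ₑ ≤
      ‖v‖ₑ * ∫⁻ s in Set.Ioc (0 : ℝ) 1, ‖sgrad φ (y + s • v)‖ₑ := by
    rw [h1, ← lintegral_const_mul _ hg.measurable]
    refine (enorm_integral_le_lintegral_enorm _).trans ?_
    refine (lintegral_mono_set (Set.Ioc_subset_Ioc_right hτ.2)).trans (lintegral_mono fun s => ?_)
    rw [← enorm_norm v, ← enorm_norm (sgrad _ _), ← enorm_mul, enorm_le_iff_norm_le]
    simpa using norm_fderiv_apply_le φ (y + s • v) v
  refine (pow_le_pow_left' h2 2).trans ?_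
  rw [mul_pow]
  gcongr
  exact lintegral_sq_le _ hg.measurable.aemeasurable

end Gradient

/-! ### Measurability and differentiation rules -/

section Values

variable {d : ℕ} {Ω : Set (Space d)}

theorem memLp_val (u : H1 Ω) : MemLp (val u) 2 (vol Ω) := Lp.memLp _

theorem memLp_grad (u : H1 Ω) : MemLp (grad u) 2 (vol Ω) := Lp.memLp _

theorem stronglyMeasurable_val (u : H1 Ω) : StronglyMeasurable (val u) := Lp.stronglyMeasurable _

theorem stronglyMeasurable_grad (u : H1 Ω) : StronglyMeasurable (grad u) := Lp.stronglyMeasurable _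

theorem stronglyMeasurable_grad_apply (u : H1 Ω) (i : Fin d) :
    StronglyMeasurable fun x => grad u x i :=
  (EuclideanSpace.proj (𝕜 := ℂ) i : EuclideanSpace ℂ (Fin d) →L[ℂ] ℂ).continuous
    |>.comp_stronglyMeasurable (stronglyMeasurable_grad u)

theorem isWeakGradient (u : H1 Ω) : IsWeakGradient Ω (val u) (grad u) := u.2

end Values

section Derivatives

variable {d : ℕ}

theorem pderiv_sum {F : Type*} [NormedAddCommGroup F] [NormedSpace ℝ F] {ι : Type*}
    (s : Finset ι) {φ : ι → Space d → F} (hφ : ∀ j ∈ s, ContDiff ℝ ∞ (φ j)) (i : Fin d)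
    (x : Space d) : pderiv i (fun y => ∑ j ∈ s, φ j y) x = ∑ j ∈ s, pderiv i (φ j) x := by
  simp only [pderiv]
  rw [fderiv_fun_sum fun j hj => ((hφ j hj).differentiable (by simp)) x]
  simp

theorem pderiv_comp_sub_mul {ρ χ : Space d → ℝ} (hρ : ContDiff ℝ ∞ ρ) (hχ : ContDiff ℝ ∞ χ)
    (i : Fin d) (y z : Space d) :
    pderiv i (fun z => ρ (y - z) * χ z) z = ρ (y - z) * pderiv i χ z - pderiv i ρ (y - z) * χ z := by
  have h1 : HasFDerivAt (fun z => ρ (y - z)) (-fderiv ℝ ρ (y - z)) z := by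
    have h2 := ((hρ.differentiable (by simp)) (y - z)).hasFDerivAt.comp z
      ((hasFDerivAt_id z).const_sub y)
    convert! h2 using 1
    ext v; simp
  have h3 := (h1.mul ((hχ.differentiable (by simp)) z).hasFDerivAt).fderiv
  simp only [pderiv]
  rw [show (fun z => ρ (y - z) * χ z) = (fun z => ρ (y - z)) * χ from rfl, h3]
  simp
  ring

end Derivatives

section Mollify

variable {d : ℕ} {ρ : Space d → ℝ} {S : Set (Space d)} {f : Space d → ℂ}

theorem IsMollifier.contDiff_mollify (hρ : IsMollifier ρ S) (hf : LocallyIntegrable f) :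
    ContDiff ℝ ∞ (mollify ρ f) :=
  hρ.hasCompactSupport.contDiff_convolution_left _ hρ.contDiff hf

theorem IsMollifier.hasCompactSupport_mollify (hρ : IsMollifier ρ S) (hf : HasCompactSupport f) :
    HasCompactSupport (mollify ρ f) :=
  hρ.hasCompactSupport.convolution _ hf

theorem IsMollifier.pderiv_mollify (hρ : IsMollifier ρ S) (hf : LocallyIntegrable f) (i : Fin d)
    (y : Space d) : pderiv i (mollify ρ f) y = ∫ z, pderiv i ρ (y - z) • f z := by
  have h1 : mollify ρ f = f ⋆[(ContinuousLinearMap.lsmul ℝ ℝ).flip, volume] ρ := by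
    rw [mollify, convolution_flip]
  have hρ1 : ContDiff ℝ 1 ρ := hρ.contDiff.of_le (by exact_mod_cast le_top)
  rw [pderiv, h1, (hρ.hasCompactSupport.hasFDerivAt_convolution_right _ hf hρ1 y).fderiv,
    convolution_precompR_apply _ hf (hρ.hasCompactSupport.fderiv ℝ)
      (hρ.contDiff.continuous_fderiv (by simp))]
  rfl

end Mollify

/-! ### Smooth approximation of a localized function -/

section Local

variable {d : ℕ} {Ω : Set (Space d)}

/-- The localization `χ u`, extended by zero. -/
noncomputable def cutVal (χ : Space d → ℝ) (u : H1 Ω) : Space d → ℂ :=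
  Ω.indicator fun x => χ x • val u x

/-- The weak gradient of `χ u`, extended by zero. -/
noncomputable def cutGrad (χ : Space d → ℝ) (u : H1 Ω) (i : Fin d) : Space d → ℂ :=
  Ω.indicator fun x => χ x • grad u x i + pderiv i χ x • val u x

variable {χ : Space d → ℝ}

theorem memLp_smul_of_hasCompactSupport {h : Space d → ℂ} {k : Space d → ℝ}
    (hk : Continuous k) (hks : HasCompactSupport k) (hh : MemLp h 2 (vol Ω)) :
    MemLp (fun x => k x • h x) 2 (vol Ω) :=
  hh.smul ((hk.memLp_of_hasCompactSupport (p := ⊤) hks).restrict Ω)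

theorem memLp_cutVal (hΩ : IsOpen Ω) (hχ : ContDiff ℝ ∞ χ) (hχs : HasCompactSupport χ) (u : H1 Ω) :
    MemLp (cutVal χ u) 2 volume :=
  (memLp_indicator_iff_restrict hΩ.measurableSet).2
    (memLp_smul_of_hasCompactSupport hχ.continuous hχs (memLp_val u))

theorem memLp_cutGrad (hΩ : IsOpen Ω) (hχ : ContDiff ℝ ∞ χ) (hχs : HasCompactSupport χ) (u : H1 Ω)
    (i : Fin d) : MemLp (cutGrad χ u i) 2 volume :=
  (memLp_indicator_iff_restrict hΩ.measurableSet).2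
    ((memLp_smul_of_hasCompactSupport hχ.continuous hχs (memLp_coord (memLp_grad u) i)).add
      (memLp_smul_of_hasCompactSupport (continuous_pderiv hχ i) (hχs.fderiv_apply ℝ _)
        (memLp_val u)))

theorem stronglyMeasurable_cutVal (hΩ : IsOpen Ω) (hχ : ContDiff ℝ ∞ χ) (u : H1 Ω) :
    StronglyMeasurable (cutVal χ u) :=
  (hχ.continuous.stronglyMeasurable.smul (stronglyMeasurable_val u)).indicator hΩ.measurableSet

theorem stronglyMeasurable_cutGrad (hΩ : IsOpen Ω) (hχ : ContDiff ℝ ∞ χ) (u : H1 Ω) (i : Fin d) :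
    StronglyMeasurable (cutGrad χ u i) :=
  ((hχ.continuous.stronglyMeasurable.smul (stronglyMeasurable_grad_apply u i)).add
    ((continuous_pderiv hχ i).stronglyMeasurable.smul (stronglyMeasurable_val u))).indicator
    hΩ.measurableSet

theorem hasCompactSupport_cutVal (hχs : HasCompactSupport χ) (u : H1 Ω) :
    HasCompactSupport (cutVal χ u) := by
  refine hχs.mono fun x hx => ?_
  rw [Function.mem_support] at hx ⊢
  intro h
  apply hx
  simp [cutVal, h]

/-- Where the shifted mollifier only sees `Ω`, differentiation passes to the weak gradient. -/
theorem IsMollifier.pderiv_mollify_cutVal {ρ : Space d → ℝ} {S : Set (Space d)}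
    (hρ : IsMollifier ρ S) (hΩ : IsOpen Ω) (hχ : ContDiff ℝ ∞ χ) (hχs : HasCompactSupport χ)
    (u : H1 Ω) (i : Fin d) {y : Space d}
    (hy : ∀ z ∈ tsupport χ, y - z ∈ tsupport ρ → z ∈ Ω) :
    pderiv i (mollify ρ (cutVal χ u)) y = mollify ρ (cutGrad χ u i) y := by
  have hu := memLp_cutVal hΩ hχ hχs u
  have hG := memLp_cutGrad hΩ hχ hχs u i
  rw [hρ.pderiv_mollify (hu.locallyIntegrable (by norm_num)), mollify_apply']
  -- By `hy` this is supported in `Ω`, hence an admissible test function for the weak gradient.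
  set ψ : Space d → ℝ := fun z => ρ (y - z) * χ z with hψ
  have hψs : tsupport ψ ⊆ tsupport χ ∩ {z | y - z ∈ tsupport ρ} := by
    refine closure_minimal (fun z hz => ?_) ((isClosed_tsupport χ).inter
      ((isClosed_tsupport ρ).preimage (continuous_const.sub continuous_id)))
    rw [Function.mem_support, hψ] at hz
    exact ⟨subset_tsupport _ (right_ne_zero_of_mul hz), subset_tsupport _ (left_ne_zero_of_mul hz)⟩
  have hψt : IsTestFunction Ω ψ := by
    refine ⟨(hρ.contDiff.comp (contDiff_const.sub contDiff_id)).mul hχ, ?_, fun z hz => ?_⟩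
    · exact hχs.of_isClosed_subset (isClosed_tsupport _) fun z hz => (hψs hz).1
    · exact hy z (hψs hz).1 (hψs hz).2
  have hw := isWeakGradient u ψ hψt i
  have i1 : Integrable (fun x => pderiv i ψ x • val u x) (vol Ω) :=
    memLp_one_iff_integrable.1 ((memLp_val u).smul (hψt.memLp_pderiv i))
  have i2 : Integrable (fun x => ψ x • grad u x i) (vol Ω) :=
    memLp_one_iff_integrable.1 ((memLp_coord (memLp_grad u) i).smul hψt.memLp)
  have i12 : Integrable (fun x => pderiv i ψ x • val u x + ψ x • grad u x i) (vol Ω) := i1.add i2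
  have i3 : Integrable (fun z => ρ (y - z) • cutGrad χ u i z) := by
    have := (hρ.integrable_smul (hG.locallyIntegrable (by norm_num)) y).comp_sub_left y
    simpa using this
  -- Product rule for `ψ`. The indicator term is the weak gradient identity tested with `ψ`, so its
  -- integral vanishes.
  have e : (fun z => pderiv i ρ (y - z) • cutVal χ u z) = fun z =>
      ρ (y - z) • cutGrad χ u i z -
        Ω.indicator (fun z => pderiv i ψ z • val u z + ψ z • grad u z i) z := by
    ext z
    by_cases hz : z ∈ Ω
    · simp only [cutVal, cutGrad, Set.indicator_of_mem hz, hψ]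
      rw [pderiv_comp_sub_mul hρ.contDiff hχ]
      simp only [Complex.real_smul, Complex.ofReal_sub, Complex.ofReal_mul]
      ring
    · simp [cutVal, cutGrad, hz]
  rw [e, integral_sub i3 ((integrable_indicator_iff hΩ.measurableSet).2 i12),
    integral_indicator hΩ.measurableSet, integral_add i1 i2, hw]
  simp

/-- With the mollifier supported in the ball of radius `t c` about `-(t • n)`, the value at `y`
depends only on points of the ball about `y + t • n`. The cone condition places that ball in `Ω`, so
the jump of the zero extension across the boundary is never seen from `Ω`. -/
theorem IsConeNhd.exists_smooth_cut {x n : Space d} {r c : ℝ} (hΩ : IsOpen Ω) (hc : 0 < c)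
    (hcone : IsConeNhd Ω (Metric.ball x r) n c) (hχ : ContDiff ℝ ∞ χ) (hχs : HasCompactSupport χ)
    (hχU : tsupport χ ⊆ Metric.ball x r) (u : H1 Ω) {ε : ℝ≥0∞} (hε : 0 < ε) :
    ∃ φ : Space d → ℂ, ContDiff ℝ ∞ φ ∧ HasCompactSupport φ ∧
      eLpNorm (fun y => φ y - cutVal χ u y) 2 (vol Ω) ≤ ε ∧
      ∀ i, eLpNorm (fun y => pderiv i φ y - cutGrad χ u i y) 2 (vol Ω) ≤ ε := by
  have hu := memLp_cutVal hΩ hχ hχs u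
  have hG := memLp_cutGrad hΩ hχ hχs u
  obtain ⟨δ₀, hδ₀, h0⟩ := exists_delta_mollify_sub_le hu (stronglyMeasurable_cutVal hΩ hχ u) hε
  choose δ hδ h1 using fun i =>
    exists_delta_mollify_sub_le (hG i) (stronglyMeasurable_cutGrad hΩ hχ u i) hε
  obtain ⟨δ₁, hδ₁, h2⟩ := hχs.isCompact.exists_thickening_subset_open Metric.isOpen_ball hχU
  have hev : ∀ᶠ t : ℝ in 𝓝[>] 0, t * (‖n‖ + c) < δ₀ ∧ t * (‖n‖ + c) < δ₁ ∧
      (∀ i, t * (‖n‖ + c) < δ i) ∧ t ≤ 1 ∧ 0 < t := by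
    have ht : Tendsto (fun t : ℝ => t * (‖n‖ + c)) (𝓝[>] 0) (𝓝 0) := by
      have : Tendsto (fun t : ℝ => t * (‖n‖ + c)) (𝓝 0) (𝓝 (0 * (‖n‖ + c))) :=
        tendsto_id.mul_const _
      rw [zero_mul] at this
      exact this.mono_left nhdsWithin_le_nhds
    refine (ht.eventually_lt_const hδ₀).and ((ht.eventually_lt_const hδ₁).and
      ((eventually_all.2 fun i => ht.eventually_lt_const (hδ i)).and (Eventually.and ?_ ?_)))
    · exact nhdsWithin_le_nhds (Iic_mem_nhds one_pos)
    · exact self_mem_nhdsWithin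
  obtain ⟨t, ht0, ht1, hti, htle, htpos⟩ := hev.exists
  set S := Metric.closedBall (-(t • n)) (t * c) with hS
  have hSn : ∀ w ∈ S, ‖w‖ ≤ t * (‖n‖ + c) := by
    intro w hw
    rw [hS, mem_closedBall_iff_norm, sub_neg_eq_add] at hw
    have : ‖w‖ ≤ ‖w + t • n‖ + ‖t • n‖ := by simpa using norm_sub_le (w + t • n) (t • n)
    rw [norm_smul, Real.norm_of_nonneg htpos.le] at this
    linarith
  have hSb : ∀ η, t * (‖n‖ + c) < η → S ⊆ Metric.ball 0 η := fun η hη w hw => by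
    rw [mem_ball_zero_iff]; exact (hSn w hw).trans_lt hη
  obtain ⟨ρ, hρ⟩ := exists_isMollifier (-(t • n)) (mul_pos htpos hc)
  refine ⟨mollify ρ (cutVal χ u), hρ.contDiff_mollify (hu.locallyIntegrable (by norm_num)),
    hρ.hasCompactSupport_mollify (hasCompactSupport_cutVal hχs u), ?_, fun i => ?_⟩
  · exact (eLpNorm_mono_measure _ Measure.restrict_le_self).trans (h0 ρ S (hSb _ ht0) hρ)
  · refine le_trans (le_of_eq ?_)
      ((eLpNorm_mono_measure _ (Measure.restrict_le_self (s := Ω))).trans (h1 i ρ S (hSb _ (hti i)) hρ))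
    refine eLpNorm_congr_ae ((ae_restrict_mem hΩ.measurableSet).mono fun y hy => ?_)
    simp only
    rw [hρ.pderiv_mollify_cutVal hΩ hχ hχs]
    intro z hz hyz
    have hyS := hρ.tsupport_subset hyz
    by_cases hyU : y ∈ Metric.ball x r
    · refine hcone y ⟨hy, hyU⟩ t ⟨htpos, htle⟩ ?_
      rw [mem_closedBall_iff_norm] at hyS ⊢
      rwa [show z - (y + t • n) = -(y - z - -(t • n)) by abel, norm_neg]
    -- Outside the chart ball, `y` is farther from the support of `χ` than the mollifier reaches.
    · refine absurd (h2 (Metric.mem_thickening_iff.2 ⟨z, hz, ?_⟩)) hyU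
      rw [dist_eq_norm]
      exact (hSn _ hyS).trans_lt ht1

end Local

/-! ### Density of smooth functions in H¹ -/

section Density

variable {d : ℕ} {Ω : Set (Space d)}

theorem IsBoundedLipschitzDomain.exists_smooth_le (hΩ : IsBoundedLipschitzDomain Ω) (u : H1 Ω)
    {ε : ℝ≥0∞} (hε : 0 < ε) :
    ∃ φ : Space d → ℂ, ContDiff ℝ ∞ φ ∧ HasCompactSupport φ ∧
      eLpNorm (fun y => φ y - val u y) 2 (vol Ω) ≤ ε ∧
      ∀ i, eLpNorm (fun y => pderiv i φ y - grad u y i) 2 (vol Ω) ≤ ε := by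
  obtain ⟨ι, _, x, r, n, c, hcone, hcover⟩ := hΩ.exists_finite_cover
  obtain ⟨χ, hχU⟩ := SmoothPartitionOfUnity.exists_isSubordinate 𝓘(ℝ, Space d)
    (isClosed_closure (s := Ω)) (fun j => Metric.ball (x j) (r j)) (fun _ => Metric.isOpen_ball)
    hcover
  have hχ : ∀ j, ContDiff ℝ ∞ (χ j) := fun j => (χ j).contMDiff.contDiff
  have hχs : ∀ j, HasCompactSupport (χ j) := fun j =>
    (isCompact_closedBall (x j) (r j)).of_isClosed_subset (isClosed_tsupport _)
      ((hχU j).trans Metric.ball_subset_closedBall)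
  have hsum : ∀ y ∈ Ω, ∑ j, χ j y = 1 := fun y hy => by
    rw [← finsum_eq_sum_of_fintype]; exact χ.sum_eq_one (subset_closure hy)
  -- This cancels the terms in which the derivative falls on a cut-off, so that the localized
  -- gradients add up to `grad u`.
  have hdsum : ∀ y ∈ Ω, ∀ i, ∑ j, pderiv i (χ j) y = 0 := fun y hy i => by
    rw [← pderiv_sum Finset.univ (fun j _ => hχ j), pderiv]
    have : (fun y => ∑ j, χ j y) =ᶠ[𝓝 y] fun _ => (1 : ℝ) :=
      by
      filter_upwards [hΩ.1.mem_nhds hy] with z hz using hsum z hz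
    rw [this.fderiv_eq]; simp
  set ε' : ℝ≥0∞ := ε / (Fintype.card ι + 1) with hε'
  have hε'0 : 0 < ε' := ENNReal.div_pos hε.ne' (by finiteness)
  have hle : ∑ _j : ι, ε' ≤ ε := by
    rw [Finset.sum_const, nsmul_eq_mul, Finset.card_univ, hε']
    calc _ ≤ ((Fintype.card ι + 1 : ℝ≥0∞)) * (ε / (Fintype.card ι + 1)) := by gcongr; simp
      _ = ε := ENNReal.mul_div_cancel (by simp) (by finiteness)
  choose φ hφ hφs h0 h1 using fun j =>
    (hcone j).2.exists_smooth_cut hΩ.1 (hcone j).1 (hχ j) (hχs j) (hχU j) u hε'0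
  have hmφ : ∀ j, AEStronglyMeasurable (fun y => φ j y - cutVal (χ j) u y) (vol Ω) := fun j =>
    (hφ j).continuous.aestronglyMeasurable.sub
      (stronglyMeasurable_cutVal hΩ.1 (hχ j) u).aestronglyMeasurable
  have hmg : ∀ i j, AEStronglyMeasurable
      (fun y => pderiv i (φ j) y - cutGrad (χ j) u i y) (vol Ω) := fun i j =>
    (continuous_pderiv (hφ j) i).aestronglyMeasurable.sub
      (stronglyMeasurable_cutGrad hΩ.1 (hχ j) u i).aestronglyMeasurable
  refine ⟨fun y => ∑ j, φ j y, ContDiff.sum fun j _ => hφ j, ?_, ?_, fun i => ?_⟩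
  · refine (isCompact_iUnion fun j => (hφs j).isCompact).of_isClosed_subset (isClosed_tsupport _)
      (closure_minimal (fun y hy => ?_) (isClosed_iUnion_of_finite fun j => isClosed_tsupport _))
    obtain ⟨j, -, hj⟩ := Finset.exists_ne_zero_of_sum_ne_zero hy
    exact Set.mem_iUnion.2 ⟨j, subset_tsupport _ hj⟩
  · refine le_trans (le_of_eq ?_) ((eLpNorm_sum_le (s := Finset.univ) (fun j _ => hmφ j)
      (by norm_num)).trans ((Finset.sum_le_sum fun j _ => h0 j).trans hle))
    refine eLpNorm_congr_ae ((ae_restrict_mem hΩ.1.measurableSet).mono fun y hy => ?_)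
    simp only [Finset.sum_apply, Finset.sum_sub_distrib, cutVal, Set.indicator_of_mem hy]
    rw [← Finset.sum_smul, hsum y hy, one_smul]
  · refine le_trans (le_of_eq ?_) ((eLpNorm_sum_le (s := Finset.univ) (fun j _ => hmg i j)
      (by norm_num)).trans ((Finset.sum_le_sum fun j _ => h1 j i).trans hle))
    refine eLpNorm_congr_ae ((ae_restrict_mem hΩ.1.measurableSet).mono fun y hy => ?_)
    simp only [Finset.sum_apply, Finset.sum_sub_distrib, cutGrad, Set.indicator_of_mem hy,
      Finset.sum_add_distrib]
    rw [← Finset.sum_smul, ← Finset.sum_smul, hsum y hy, hdsum y hy, one_smul, zero_smul, add_zero,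
      pderiv_sum _ fun j _ => hφ j]

/-- `φ k` is a sequence of smooth compactly supported functions converging to `u` in `H¹(Ω)`. -/
structure IsSmoothApprox (φ : ℕ → Space d → ℂ) (u : H1 Ω) : Prop where
  contDiff : ∀ k, ContDiff ℝ ∞ (φ k)
  hasCompactSupport : ∀ k, HasCompactSupport (φ k)
  tendsto_val : Tendsto (fun k => eLpNorm (fun x => φ k x - val u x) 2 (vol Ω)) atTop (𝓝 0)
  tendsto_grad : ∀ i, Tendsto (fun k => eLpNorm (fun x => pderiv i (φ k) x - grad u x i) 2 (vol Ω))
    atTop (𝓝 0)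

/-- Density of smooth functions in `H¹` of a bounded Lipschitz domain. -/
theorem IsBoundedLipschitzDomain.exists_isSmoothApprox (hΩ : IsBoundedLipschitzDomain Ω)
    (u : H1 Ω) : ∃ φ, IsSmoothApprox φ u := by
  choose φ hφ hφs h0 h1 using fun k : ℕ =>
    hΩ.exists_smooth_le u (ε := ((k : ℝ≥0∞) + 1)⁻¹) (by simp)
  have ht : Tendsto (fun k : ℕ => ((k : ℝ≥0∞) + 1)⁻¹) atTop (𝓝 0) := by
    have := ENNReal.tendsto_inv_nat_nhds_zero.comp (tendsto_add_atTop_nat 1)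
    simpa [Function.comp_def] using this
  exact ⟨φ, hφ, hφs, tendsto_of_tendsto_of_tendsto_of_le_of_le tendsto_const_nhds ht
    (fun _ => zero_le) h0, fun i => tendsto_of_tendsto_of_tendsto_of_le_of_le
    tendsto_const_nhds ht (fun _ => zero_le) fun k => h1 k i⟩

end Density

theorem enn_add_sq_le (a b : ℝ≥0∞) : (a + b) ^ 2 ≤ 2 * (a ^ 2 + b ^ 2) := by
  rcases eq_or_ne a ⊤ with rfl | ha
  · simp
  rcases eq_or_ne b ⊤ with rfl | hb
  · simp
  lift a to ℝ≥0 using ha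
  lift b to ℝ≥0 using hb
  have h : (a + b) ^ 2 ≤ 2 * (a ^ 2 + b ^ 2) := by
    rw [← NNReal.coe_le_coe]
    push_cast
    exact add_sq_le
  exact_mod_cast h

theorem lintegral_two_mul_add {α : Type*} [MeasurableSpace α] (μ : Measure α) {f g : α → ℝ≥0∞}
    (hf : Measurable f) (hg : Measurable g) (c : ℝ≥0∞) :
    ∫⁻ x, 2 * (f x + c * g x) ∂μ = 2 * ((∫⁻ x, f x ∂μ) + c * ∫⁻ x, g x ∂μ) := by
  have h : Measurable fun x => f x + c * g x := hf.add (hg.const_mul c)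
  rw [lintegral_const_mul _ h, lintegral_add_left hf, lintegral_const_mul _ hg]

/-! ### Hyperplane coordinates and Fubini -/

section Hyperplane

variable {d : ℕ}

theorem coe_orthogonalProjectionOnto_add {n : Space d} (hn : ‖n‖ = 1) (y : Space d) :
    ((ℝ ∙ n)ᗮ.orthogonalProjectionOnto y : Space d) + ⟪n, y⟫_ℝ • n = y := by
  have h := (ℝ ∙ n).starProjection_add_starProjection_orthogonal y
  rw [Submodule.starProjection_unit_singleton ℝ hn] at h
  rw [add_comm]
  exact h

theorem inner_coe_orthogonal (n : Space d) (y : ((ℝ ∙ n)ᗮ : Submodule ℝ (Space d))) :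
    ⟪n, (y : Space d)⟫_ℝ = 0 :=
  Submodule.mem_orthogonal_singleton_iff_inner_right.1 y.2

/-- The linear coordinates `(y', s) ↦ y' + s T n`. -/
noncomputable def hyperplaneCoord {n : Space d} (hn : ‖n‖ = 1) {T : ℝ} (hT : T ≠ 0) :
    (((ℝ ∙ n)ᗮ : Submodule ℝ (Space d)) × ℝ) ≃L[ℝ] Space d :=
  LinearEquiv.toContinuousLinearEquiv
    { toFun := fun p => (p.1 : Space d) + p.2 • T • n
      map_add' := fun p q => by simp only [Prod.fst_add, Prod.snd_add, Submodule.coe_add]; module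
      map_smul' := fun a p => by
        simp only [Prod.smul_fst, Prod.smul_snd, Submodule.coe_smul, RingHom.id_apply, smul_eq_mul]
        module
      invFun := fun y => ((ℝ ∙ n)ᗮ.orthogonalProjectionOnto y, ⟪n, y⟫_ℝ / T)
      left_inv := fun p => by
        ext1
        · simp [smul_smul, -map_smul]
        · simp only [inner_add_right, inner_coe_orthogonal, zero_add]
          rw [smul_smul, inner_smul_self_of_norm_eq_one hn]
          field_simp
      right_inv := fun y => by
        simp only
        rw [smul_smul, div_mul_cancel₀ _ hT, coe_orthogonalProjectionOnto_add hn] }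

theorem isAddHaarMeasure_hyperplane {n : Space d} (hn : ‖n‖ = 1) :
    (μHE[d - 1] : Measure ((ℝ ∙ n)ᗮ : Submodule ℝ (Space d))).IsAddHaarMeasure := by
  have hn0 : n ≠ 0 := by rintro rfl; simp at hn
  -- Excludes truncation in `d - 1`.
  have hd : d ≠ 0 := by
    rintro rfl
    exact hn0 (Subsingleton.elim _ _)
  have : Fact (Module.finrank ℝ (Space d) = (d - 1) + 1) := ⟨by
    rw [finrank_euclideanSpace_fin]; omega⟩
  have h := Submodule.finrank_orthogonal_span_singleton (𝕜 := ℝ) (n := d - 1) hn0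
  have h1 := isAddHaarMeasure_euclideanHausdorffMeasure
    (E := ((ℝ ∙ n)ᗮ : Submodule ℝ (Space d)))
  rwa [h] at h1

/-- The product measure carried over by a linear isomorphism is translation invariant, hence a
multiple of Lebesgue measure. The value of the factor plays no role. -/
theorem exists_lintegral_hyperplane {n : Space d} (hn : ‖n‖ = 1) {T : ℝ} (hT : T ≠ 0) :
    ∃ C : ℝ≥0, ∀ k : Space d → ℝ≥0∞, Measurable k →
      ∫⁻ y : ((ℝ ∙ n)ᗮ : Submodule ℝ (Space d)), ∫⁻ s : ℝ, k (y + s • T • n) ∂volume ∂μHE[d - 1] =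
        C * ∫⁻ y, k y := by
  have := isAddHaarMeasure_hyperplane hn
  set μ : Measure ((ℝ ∙ n)ᗮ : Submodule ℝ (Space d)) := μHE[d - 1]
  set Φ := hyperplaneCoord hn hT
  refine ⟨((μ.prod volume).map Φ).addHaarScalarFactor volume, fun k hk => ?_⟩
  have h1 := Measure.isAddLeftInvariant_eq_smul ((μ.prod volume).map Φ) volume
  calc _ = ∫⁻ p, k (Φ p) ∂(μ.prod volume) := by
        rw [lintegral_prod (fun p => k (Φ p)) (hk.comp Φ.continuous.measurable).aemeasurable]
        rfl
    _ = ∫⁻ y, k y ∂((μ.prod volume).map Φ) := (lintegral_map hk Φ.continuous.measurable).symm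
    _ = _ := by
        conv_lhs => rw [h1]
        rw [lintegral_smul_measure]; rfl

end Hyperplane

/-! ### Surface measure of Lipschitz graphs -/

section Graph

variable {d : ℕ} {n : Space d} {g : ((ℝ ∙ n)ᗮ : Submodule ℝ (Space d)) → ℝ} {K : ℝ≥0}

/-- The graph map of `g` over the hyperplane orthogonal to `n`. -/
noncomputable def graphMap (n : Space d) (g : ((ℝ ∙ n)ᗮ : Submodule ℝ (Space d)) → ℝ)
    (y : ((ℝ ∙ n)ᗮ : Submodule ℝ (Space d))) : Space d := y + g y • n

theorem lipschitzWith_graphMap (hn : ‖n‖ = 1) (hg : LipschitzWith K g) :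
    LipschitzWith (1 + K) (graphMap n g) := by
  refine LipschitzWith.add (Submodule.subtypeₗᵢ _).lipschitz (LipschitzWith.of_dist_le_mul fun x y => ?_)
  rw [dist_eq_norm, ← sub_smul, norm_smul, hn, mul_one, ← dist_eq_norm]
  exact hg.dist_le_mul x y

/-- A `(1 + K)`-Lipschitz map enlarges `m`-dimensional Hausdorff measure by at most `(1 + K) ^ m`.
This one-sided bound replaces the area formula. -/
theorem exists_restrict_le_map_graphMap (hn : ‖n‖ = 1) (hg : LipschitzWith K g) (m : ℕ) :
    ∃ C : ℝ≥0, ∀ F : Set (Space d),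
      (∀ y ∈ F, ⟪n, y⟫_ℝ = g ((ℝ ∙ n)ᗮ.orthogonalProjectionOnto y)) →
      (μHE[m] : Measure (Space d)).restrict F ≤ C • (μHE[m]).map (graphMap n g) := by
  refine ⟨(1 + K) ^ m, fun F hF => Measure.le_iff.2 fun s hs => ?_⟩
  have hG := lipschitzWith_graphMap hn hg
  have hsub : s ∩ F ⊆ graphMap n g '' (graphMap n g ⁻¹' s) := by
    rintro y ⟨hys, hyF⟩
    have e : graphMap n g ((ℝ ∙ n)ᗮ.orthogonalProjectionOnto y) = y := by
      rw [graphMap, ← hF y hyF, coe_orthogonalProjectionOnto_add hn]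
    exact ⟨_, by rwa [Set.mem_preimage, e], e⟩
  rw [Measure.restrict_apply hs, Measure.smul_apply,
    Measure.map_apply hG.continuous.measurable hs]
  refine (measure_mono hsub).trans ?_
  rw [Measure.euclideanHausdorffMeasure_def, Measure.euclideanHausdorffMeasure_def,
    Measure.smul_apply, Measure.smul_apply, ENNReal.smul_def, ENNReal.smul_def, ENNReal.smul_def,
    smul_eq_mul, smul_eq_mul, smul_eq_mul, mul_left_comm]
  gcongr
  have := hG.hausdorffMeasure_image_le (d := m) (by positivity) (graphMap n g ⁻¹' s)
  rw [ENNReal.rpow_natCast] at this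
  exact_mod_cast this

end Graph

/-! ### The trace inequality for smooth functions -/

section Frontier

variable {d : ℕ} {Ω : Set (Space d)}

theorem inner_eq_of_mem_frontier_chart {x n : Space d} {r : ℝ} (hΩo : IsOpen Ω)
    {g : ((ℝ ∙ n)ᗮ : Submodule ℝ (Space d)) → ℝ} (hg : Continuous g)
    (hΩ : ∀ y ∈ Metric.ball x r, (y ∈ Ω ↔ g ((ℝ ∙ n)ᗮ.orthogonalProjectionOnto y) < ⟪n, y⟫_ℝ))
    {y : Space d} (hy : y ∈ frontier Ω) (hyr : y ∈ Metric.ball x r) :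
    ⟪n, y⟫_ℝ = g ((ℝ ∙ n)ᗮ.orthogonalProjectionOnto y) := by
  rw [hΩo.frontier_eq] at hy
  refine le_antisymm (not_lt.1 fun h => hy.2 ((hΩ y hyr).2 h)) (not_lt.1 fun h => ?_)
  have h1 : ∀ᶠ z in 𝓝 y, ⟪n, z⟫_ℝ < g ((ℝ ∙ n)ᗮ.orthogonalProjectionOnto z) :=
    (isOpen_lt (by fun_prop) (hg.comp (by fun_prop))).mem_nhds h
  obtain ⟨z, ⟨hz1, hz2⟩, hz3⟩ := mem_closure_iff_nhds.1 hy.1 _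
    (h1.and (Metric.isOpen_ball.mem_nhds hyr))
  exact lt_asymm hz1 ((hΩ z hz2).1 hz3)

/-- The segments from the boundary in direction `v` stay in `Ω`. Pulling the surface integral back
to the hyperplane turns the left side into an integral over vertical lines, which Fubini compares
with the volume integral. -/
theorem IsBoundedLipschitzDomain.exists_collar (hΩ : IsBoundedLipschitzDomain Ω) {x : Space d}
    (hx : x ∈ frontier Ω) :
    ∃ r > 0, ∃ (v : Space d) (C : ℝ≥0), ∀ h : Space d → ℝ≥0∞, Measurable h →
      ∫⁻ y in frontier Ω ∩ Metric.ball x r, (∫⁻ s in Set.Ioc (0 : ℝ) 1, h (y + s • v)) ∂μHE[d - 1] ≤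
        C * ∫⁻ y in Ω, h y := by
  obtain ⟨r, hr, n, hn, g, K, hg, hU⟩ := hΩ.2.2 x hx
  have hT : r / 2 ≠ 0 := by positivity
  obtain ⟨C₁, hC₁⟩ := exists_restrict_le_map_graphMap hn hg (d - 1)
  obtain ⟨C₂, hC₂⟩ := exists_lintegral_hyperplane hn hT
  refine ⟨r / 2, by positivity, (r / 2) • n, C₁ * C₂, fun h hh => ?_⟩
  set F := frontier Ω ∩ Metric.ball x (r / 2) with hF
  have hFm : MeasurableSet F := measurableSet_frontier.inter measurableSet_ball
  have hFg : ∀ y ∈ F, ⟪n, y⟫_ℝ = g ((ℝ ∙ n)ᗮ.orthogonalProjectionOnto y) := fun y hy =>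
    inner_eq_of_mem_frontier_chart hΩ.1 hg.continuous hU hy.1
      (Metric.ball_subset_ball (by linarith) hy.2)
  have hFΩ : ∀ y ∈ F, ∀ s ∈ Set.Ioc (0 : ℝ) 1, y + s • (r / 2) • n ∈ Ω := by
    intro y hy s hs
    have hsn : ‖s • (r / 2) • n‖ ≤ r / 2 := by
      rw [norm_smul, norm_smul, hn, mul_one, Real.norm_of_nonneg hs.1.le,
        Real.norm_of_nonneg (by positivity)]
      nlinarith [hs.2]
    rw [hU]
    · rw [smul_smul, map_add, orthogonalProjectionOnto_smul_self, add_zero, inner_add_right,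
        inner_smul_self_of_norm_eq_one hn, ← hFg y hy]
      have := hs.1
      have : 0 < s * (r / 2) := by positivity
      linarith
    · have h1 := Metric.mem_ball.1 hy.2
      have h2 : dist (y + s • (r / 2) • n) y ≤ r / 2 := by rwa [dist_eq_norm, add_sub_cancel_left]
      rw [Metric.mem_ball]
      linarith [dist_triangle (y + s • (r / 2) • n) y x]
  set k := Ω.indicator h with hk
  have hkm : Measurable k := hh.indicator hΩ.1.measurableSet
  set H : Space d → ℝ≥0∞ := fun y => ∫⁻ s : ℝ, k (y + s • (r / 2) • n) with hH
  have hHm : Measurable H := by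
    refine Measurable.lintegral_prod_right' (f := fun p : Space d × ℝ =>
      k (p.1 + p.2 • (r / 2) • n)) (hkm.comp ?_)
    exact (by fun_prop : Continuous fun p : Space d × ℝ => p.1 + p.2 • (r / 2) • n).measurable
  have hHG : ∀ y, H (graphMap n g y) = ∫⁻ s : ℝ, k (y + s • (r / 2) • n) := by
    intro y
    -- Translation invariance in `s` flattens the graph without differentiating `g`.
    rw [hH, ← lintegral_add_left_eq_self (fun s : ℝ => k (y + s • (r / 2) • n)) (g y / (r / 2))]
    refine lintegral_congr fun s => ?_
    rw [graphMap, add_smul, smul_smul (g y / (r / 2)), div_mul_cancel₀ _ hT, add_assoc]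
  calc _ ≤ ∫⁻ y in F, H y ∂μHE[d - 1] := by
        refine setLIntegral_mono hHm fun y hy => ?_
        refine le_trans (le_of_eq ?_) (setLIntegral_le_lintegral (Set.Ioc (0 : ℝ) 1) _)
        refine setLIntegral_congr_fun measurableSet_Ioc fun s hs => ?_
        simp only [hk]
        rw [Set.indicator_of_mem (hFΩ y hy s hs)]
    _ ≤ ∫⁻ y, H y ∂(C₁ • (μHE[d - 1]).map (graphMap n g)) := lintegral_mono' (hC₁ F hFg) le_rfl
    _ = C₁ * ∫⁻ y, H (graphMap n g y) ∂μHE[d - 1] := by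
        rw [lintegral_smul_measure,
          lintegral_map hHm (lipschitzWith_graphMap hn hg).continuous.measurable]
        rfl
    _ = C₁ * (C₂ * ∫⁻ y, k y) := by simp only [hHG, hC₂ k hkm]
    _ = _ := by rw [hk, lintegral_indicator hΩ.1.measurableSet, ENNReal.coe_mul, mul_assoc]

/-- Trace inequality for smooth functions. -/
theorem IsBoundedLipschitzDomain.exists_trace_le (hΩ : IsBoundedLipschitzDomain Ω) :
    ∃ C : ℝ≥0, ∀ φ : Space d → ℂ, ContDiff ℝ ∞ φ →
      ∫⁻ y, ‖φ y‖ₑ ^ 2 ∂(surf Ω) ≤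
        C * ((∫⁻ y in Ω, ‖φ y‖ₑ ^ 2) + ∫⁻ y in Ω, ‖sgrad φ y‖ₑ ^ 2) := by
  have hc : IsCompact (frontier Ω) :=
    hΩ.2.1.isCompact_closure.of_isClosed_subset isClosed_frontier frontier_subset_closure
  choose r hr v C hC using fun x : frontier Ω => hΩ.exists_collar x.2
  obtain ⟨t, ht⟩ := hc.elim_finite_subcover (fun x : frontier Ω => Metric.ball (x : Space d) (r x))
    (fun _ => Metric.isOpen_ball)
    (fun y hy => Set.mem_iUnion.2 ⟨⟨y, hy⟩, Metric.mem_ball_self (hr _)⟩)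
  refine ⟨∑ x : t, C x * (2 * (1 + ‖v x‖₊ ^ 2)), fun φ hφ => ?_⟩
  have hm1 : Measurable fun y => ‖φ y‖ₑ ^ 2 := hφ.continuous.enorm.measurable.pow_const 2
  have hm2 : Measurable fun y => ‖sgrad φ y‖ₑ ^ 2 :=
    (continuous_sgrad hφ).enorm.measurable.pow_const 2
  set I := (∫⁻ y in Ω, ‖φ y‖ₑ ^ 2) + ∫⁻ y in Ω, ‖sgrad φ y‖ₑ ^ 2 with hI
  have hloc : ∀ x : frontier Ω, ∫⁻ y in frontier Ω ∩ Metric.ball (x : Space d) (r x), ‖φ y‖ₑ ^ 2 ∂μHE[d - 1] ≤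
      (C x * (2 * (1 + ‖v x‖₊ ^ 2)) : ℝ≥0) * I := by
    intro x
    -- From `φ y = φ (y + s v) - (φ (y + s v) - φ y)` and `(a + b)² ≤ 2 (a² + b²)`, averaged over
    -- `s` in the unit interval.
    set h : Space d → ℝ≥0∞ := fun y => 2 * (‖φ y‖ₑ ^ 2 + ‖v x‖ₑ ^ 2 * ‖sgrad φ y‖ₑ ^ 2) with hh
    have hhm : Measurable h := (hm1.add (hm2.const_mul _)).const_mul _
    have hp : ∀ y, ‖φ y‖ₑ ^ 2 ≤ ∫⁻ s in Set.Ioc (0 : ℝ) 1, h (y + s • v x) := by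
      intro y
      have hc1 : Measurable fun s : ℝ => y + s • v x :=
        (by fun_prop : Continuous fun s : ℝ => y + s • v x).measurable
      have e : ∫⁻ s in Set.Ioc (0 : ℝ) 1, h (y + s • v x) =
          ∫⁻ s in Set.Ioc (0 : ℝ) 1, 2 * (‖φ (y + s • v x)‖ₑ ^ 2 + ‖v x‖ₑ ^ 2 *
            ∫⁻ s in Set.Ioc (0 : ℝ) 1, ‖sgrad φ (y + s • v x)‖ₑ ^ 2) := by
        have e1 := lintegral_two_mul_add (volume.restrict (Set.Ioc (0 : ℝ) 1)) (hm1.comp hc1)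
          (hm2.comp hc1) (‖v x‖ₑ ^ 2)
        have e2 := lintegral_two_mul_add (volume.restrict (Set.Ioc (0 : ℝ) 1)) (hm1.comp hc1)
          (measurable_const (a := ∫⁻ s in Set.Ioc (0 : ℝ) 1, ‖sgrad φ (y + s • v x)‖ₑ ^ 2))
          (‖v x‖ₑ ^ 2)
        simp only [Function.comp_apply] at e1 e2
        rw [e1, e2]
        simp
      rw [e]
      calc ‖φ y‖ₑ ^ 2 = ∫⁻ _ in Set.Ioc (0 : ℝ) 1, ‖φ y‖ₑ ^ 2 := by simp
        _ ≤ _ := setLIntegral_mono'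
          measurableSet_Ioc fun s hs => ?_
      have h1 := enorm_sub_sq_le_lintegral_sgrad hφ y (v x) hs
      have h2 : ‖φ y‖ₑ ≤ ‖φ (y + s • v x)‖ₑ + ‖φ (y + s • v x) - φ y‖ₑ := by
        have := enorm_sub_le (a := φ (y + s • v x)) (b := φ (y + s • v x) - φ y)
        simpa using this
      calc ‖φ y‖ₑ ^ 2 ≤ (‖φ (y + s • v x)‖ₑ + ‖φ (y + s • v x) - φ y‖ₑ) ^ 2 := by gcongr
        _ ≤ 2 * (‖φ (y + s • v x)‖ₑ ^ 2 + ‖φ (y + s • v x) - φ y‖ₑ ^ 2) :=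
            enn_add_sq_le _ _
        _ ≤ _ := by gcongr
    calc _ ≤ ∫⁻ y in frontier Ω ∩ Metric.ball (x : Space d) (r x),
          (∫⁻ s in Set.Ioc (0 : ℝ) 1, h (y + s • v x)) ∂μHE[d - 1] := lintegral_mono fun y => hp y
      _ ≤ C x * ∫⁻ y in Ω, h y := hC x h hhm
      _ ≤ C x * ((2 * (1 + ‖v x‖₊ ^ 2) : ℝ≥0) * I) := by
          gcongr
          rw [hh, lintegral_two_mul_add _ hm1 hm2, hI, ENNReal.coe_mul, mul_assoc]
          simp only [ENNReal.coe_ofNat, ENNReal.coe_add, ENNReal.coe_one, ENNReal.coe_pow]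
          gcongr
          rw [mul_add]
          gcongr
          · exact le_mul_of_one_le_left zero_le (by simp)
          · exact le_add_self
      _ = _ := by rw [ENNReal.coe_mul (C x), mul_assoc]
  calc ∫⁻ y, ‖φ y‖ₑ ^ 2 ∂(surf Ω)
      ≤ ∫⁻ y in ⋃ x : t, frontier Ω ∩ Metric.ball (x : frontier Ω).1 (r x), ‖φ y‖ₑ ^ 2 ∂μHE[d - 1] := by
        refine lintegral_mono_set fun y hy => ?_
        obtain ⟨x, hx, hyx⟩ := Set.mem_iUnion₂.1 (ht hy)
        exact Set.mem_iUnion.2 ⟨⟨x, hx⟩, hy, hyx⟩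
    _ ≤ ∑ x : t, ∫⁻ y in frontier Ω ∩ Metric.ball (x : frontier Ω).1 (r x), ‖φ y‖ₑ ^ 2 ∂μHE[d - 1] := by
        rw [← tsum_fintype (L := .unconditional _)]; exact lintegral_iUnion_le _ _
    _ ≤ ∑ x : t, (C x * (2 * (1 + ‖v x‖₊ ^ 2)) : ℝ≥0) * I := Finset.sum_le_sum fun x _ => hloc x
    _ = _ := by rw [← Finset.sum_mul, ENNReal.ofNNReal_finsetSum]

end Frontier

/-! ### Linear combinations of approximating sequences -/

section Derivatives

variable {d : ℕ} {φ ψ : Space d → ℂ}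

theorem pderiv_add (hφ : ContDiff ℝ ∞ φ) (hψ : ContDiff ℝ ∞ ψ) (i : Fin d) (x : Space d) :
    pderiv i (fun y => φ y + ψ y) x = pderiv i φ x + pderiv i ψ x := by
  simp only [pderiv]
  rw [fderiv_fun_add ((hφ.differentiable (by simp)) x) ((hψ.differentiable (by simp)) x)]
  rfl

theorem pderiv_sub (hφ : ContDiff ℝ ∞ φ) (hψ : ContDiff ℝ ∞ ψ) (i : Fin d) (x : Space d) :
    pderiv i (fun y => φ y - ψ y) x = pderiv i φ x - pderiv i ψ x := by
  simp only [pderiv]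
  rw [fderiv_fun_sub ((hφ.differentiable (by simp)) x) ((hψ.differentiable (by simp)) x)]
  rfl

theorem pderiv_const_mul (hφ : ContDiff ℝ ∞ φ) (c : ℂ) (i : Fin d) (x : Space d) :
    pderiv i (fun y => c * φ y) x = c * pderiv i φ x := by
  simp only [pderiv]
  rw [fderiv_const_mul ((hφ.differentiable (by simp)) x)]
  rfl

end Derivatives

section Sequences

variable {α E : Type*} [MeasurableSpace α] [NormedAddCommGroup E] {μ : Measure α}

theorem tendsto_eLpNorm_add_sub {φ ψ : ℕ → α → E} {f g h : α → E}
    (hφ : ∀ k, AEStronglyMeasurable (φ k) μ) (hψ : ∀ k, AEStronglyMeasurable (ψ k) μ)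
    (hf : AEStronglyMeasurable f μ) (hg : AEStronglyMeasurable g μ)
    (h1 : Tendsto (fun k => eLpNorm (fun x => φ k x - f x) 2 μ) atTop (𝓝 0))
    (h2 : Tendsto (fun k => eLpNorm (fun x => ψ k x - g x) 2 μ) atTop (𝓝 0))
    (hh : h =ᵐ[μ] fun x => f x + g x) :
    Tendsto (fun k => eLpNorm (fun x => φ k x + ψ k x - h x) 2 μ) atTop (𝓝 0) := by
  refine tendsto_of_tendsto_of_tendsto_of_le_of_le tendsto_const_nhds (by simpa using h1.add h2)
    (fun _ => zero_le) fun k => ?_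
  refine le_trans (le_of_eq ?_)
    (eLpNorm_add_le ((hφ k).sub hf) ((hψ k).sub hg) (by norm_num))
  refine eLpNorm_congr_ae (hh.mono fun x hx => ?_)
  simp only [hx, Pi.add_apply]
  exact add_sub_add_comm _ _ _ _

theorem tendsto_eLpNorm_smul_sub {φ : ℕ → α → ℂ} {f h : α → ℂ} (c : ℂ)
    (h1 : Tendsto (fun k => eLpNorm (fun x => φ k x - f x) 2 μ) atTop (𝓝 0))
    (hh : h =ᵐ[μ] fun x => c * f x) :
    Tendsto (fun k => eLpNorm (fun x => c * φ k x - h x) 2 μ) atTop (𝓝 0) := by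
  have h3 := ENNReal.Tendsto.const_mul (a := ‖c‖ₑ) h1 (Or.inr (by simp))
  rw [mul_zero] at h3
  refine h3.congr fun k => ?_
  rw [← eLpNorm_const_smul]
  refine eLpNorm_congr_ae (hh.mono fun x hx => ?_)
  simp only [hx, Pi.smul_apply, smul_eq_mul]
  ring

end Sequences

section Algebra

variable {d : ℕ} {Ω : Set (Space d)}

theorem val_add (u v : H1 Ω) : val (u + v) =ᵐ[vol Ω] fun x => val u x + val v x :=
  Lp.coeFn_add u.1.fst v.1.fst

theorem grad_add (u v : H1 Ω) : grad (u + v) =ᵐ[vol Ω] fun x => grad u x + grad v x :=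
  Lp.coeFn_add u.1.snd v.1.snd

theorem val_smul (c : ℂ) (u : H1 Ω) : val (c • u) =ᵐ[vol Ω] fun x => c * val u x :=
  Lp.coeFn_smul c u.1.fst

theorem grad_smul (c : ℂ) (u : H1 Ω) : grad (c • u) =ᵐ[vol Ω] fun x => c • grad u x :=
  Lp.coeFn_smul c u.1.snd

theorem isTrace_iff {u : H1 Ω} {γ : Lp ℂ 2 (surf Ω)} :
    IsTrace u γ ↔ ∃ φ, IsSmoothApprox φ u ∧
      Tendsto (fun k => eLpNorm (fun x => φ k x - γ x) 2 (surf Ω)) atTop (𝓝 0) :=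
  ⟨fun ⟨φ, h1, h2, h3, h4⟩ => ⟨φ, ⟨fun k => (h1 k).1, fun k => (h1 k).2, h2, h3⟩, h4⟩,
    fun ⟨φ, h, h4⟩ => ⟨φ, fun k => ⟨h.1 k, h.2 k⟩, h.3, h.4, h4⟩⟩

theorem IsSmoothApprox.add {φ ψ : ℕ → Space d → ℂ} {u v : H1 Ω} (hφ : IsSmoothApprox φ u)
    (hψ : IsSmoothApprox ψ v) : IsSmoothApprox (fun k x => φ k x + ψ k x) (u + v) where
  contDiff k := (hφ.1 k).add (hψ.1 k)
  hasCompactSupport k := (hφ.2 k).add (hψ.2 k)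
  tendsto_val := tendsto_eLpNorm_add_sub (fun k => (hφ.1 k).continuous.aestronglyMeasurable)
    (fun k => (hψ.1 k).continuous.aestronglyMeasurable) (memLp_val u).1 (memLp_val v).1 hφ.3 hψ.3
    (val_add u v)
  tendsto_grad i := by
    simp only [pderiv_add (hφ.1 _) (hψ.1 _)]
    exact tendsto_eLpNorm_add_sub (fun k => (continuous_pderiv (hφ.1 k) i).aestronglyMeasurable)
      (fun k => (continuous_pderiv (hψ.1 k) i).aestronglyMeasurable)
      (memLp_coord (memLp_grad u) i).1 (memLp_coord (memLp_grad v) i).1 (hφ.4 i) (hψ.4 i)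
      ((grad_add u v).mono fun x hx => by simp only [hx]; rfl)

theorem IsSmoothApprox.smul (c : ℂ) {φ : ℕ → Space d → ℂ} {u : H1 Ω} (hφ : IsSmoothApprox φ u) :
    IsSmoothApprox (fun k x => c * φ k x) (c • u) where
  contDiff k := contDiff_const.mul (hφ.1 k)
  hasCompactSupport k := (hφ.2 k).mul_left
  tendsto_val := tendsto_eLpNorm_smul_sub c hφ.3 (val_smul c u)
  tendsto_grad i := by
    simp only [pderiv_const_mul (hφ.1 _)]
    exact tendsto_eLpNorm_smul_sub c (hφ.4 i) ((grad_smul c u).mono fun x hx => by simp only [hx]; rfl)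

theorem IsTrace.add {u v : H1 Ω} {γ δ : Lp ℂ 2 (surf Ω)} (hu : IsTrace u γ) (hv : IsTrace v δ) :
    IsTrace (u + v) (γ + δ) := by
  obtain ⟨φ, hφ, hφγ⟩ := isTrace_iff.1 hu
  obtain ⟨ψ, hψ, hψδ⟩ := isTrace_iff.1 hv
  exact isTrace_iff.2 ⟨_, hφ.add hψ, tendsto_eLpNorm_add_sub
    (fun k => (hφ.1 k).continuous.aestronglyMeasurable)
    (fun k => (hψ.1 k).continuous.aestronglyMeasurable) (Lp.memLp γ).1 (Lp.memLp δ).1 hφγ hψδ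
    (Lp.coeFn_add γ δ)⟩

theorem IsTrace.smul (c : ℂ) {u : H1 Ω} {γ : Lp ℂ 2 (surf Ω)} (hu : IsTrace u γ) :
    IsTrace (c • u) (c • γ) := by
  obtain ⟨φ, hφ, hφγ⟩ := isTrace_iff.1 hu
  exact isTrace_iff.2 ⟨_, hφ.smul c, tendsto_eLpNorm_smul_sub c hφγ (Lp.coeFn_smul c γ)⟩

theorem enorm_val_le (u : H1 Ω) : eLpNorm (val u) 2 (vol Ω) ≤ ‖u‖ₑ := by
  rw [val, ← Lp.enorm_def, enorm_le_iff_norm_le]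
  exact WithLp.norm_fst_le (p := 2) _ u.1

theorem enorm_grad_le (u : H1 Ω) : eLpNorm (grad u) 2 (vol Ω) ≤ ‖u‖ₑ := by
  rw [grad, ← Lp.enorm_def, enorm_le_iff_norm_le]
  exact WithLp.norm_snd_le (p := 2) _ u.1

theorem enorm_grad_apply_le (u : H1 Ω) (i : Fin d) :
    eLpNorm (fun x => grad u x i) 2 (vol Ω) ≤ ‖u‖ₑ :=
  (eLpNorm_mono fun x => PiLp.norm_apply_le (grad u x) i).trans (enorm_grad_le u)

end Algebra

/-! ### Existence, uniqueness and boundedness of the trace -/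

section Trace

variable {d : ℕ} {Ω : Set (Space d)}

/-- The (equivalent) `H¹(Ω)` norm of a smooth function. -/
noncomputable def energy (Ω : Set (Space d)) (φ : Space d → ℂ) : ℝ≥0∞ :=
  eLpNorm φ 2 (vol Ω) + ∑ i, eLpNorm (pderiv i φ) 2 (vol Ω)

theorem eLpNorm_vector_le {α : Type*} [MeasurableSpace α] {μ : Measure α}
    {G : α → EuclideanSpace ℂ (Fin d)} (hG : AEStronglyMeasurable G μ) :
    eLpNorm G 2 μ ≤ ∑ i, eLpNorm (fun x => G x i) 2 μ := by
  have hm : ∀ i, AEStronglyMeasurable (fun x => ‖G x i‖) μ := fun i =>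
    ((EuclideanSpace.proj (𝕜 := ℂ) i : EuclideanSpace ℂ (Fin d) →L[ℂ] ℂ).continuous
      |>.comp_aestronglyMeasurable hG).norm
  calc eLpNorm G 2 μ ≤ eLpNorm (∑ i, fun x => ‖G x i‖) 2 μ := by
        refine eLpNorm_mono_real fun x => ?_
        rw [EuclideanSpace.norm_eq, Finset.sum_apply]
        exact Real.sqrt_le_iff.2 ⟨Finset.sum_nonneg fun i _ => norm_nonneg _,
          Finset.sum_sq_le_sq_sum_of_nonneg fun i _ => norm_nonneg _⟩
    _ ≤ ∑ i, eLpNorm (fun x => ‖G x i‖) 2 μ := eLpNorm_sum_le (fun i _ => hm i) (by norm_num)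
    _ = _ := by simp only [eLpNorm_norm]

theorem IsBoundedLipschitzDomain.exists_eLpNorm_surf_le (hΩ : IsBoundedLipschitzDomain Ω) :
    ∃ C : ℝ≥0, ∀ φ : Space d → ℂ, ContDiff ℝ ∞ φ → eLpNorm φ 2 (surf Ω) ≤ C * energy Ω φ := by
  obtain ⟨C, hC⟩ := hΩ.exists_trace_le
  refine ⟨NNReal.sqrt C, fun φ hφ => ?_⟩
  rw [eLpNorm_two_le_iff, mul_pow]
  have h1 : ((NNReal.sqrt C : ℝ≥0) : ℝ≥0∞) ^ 2 = C := by
    rw [← ENNReal.coe_pow, NNReal.sq_sqrt]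
  rw [h1]
  refine (hC φ hφ).trans ?_
  gcongr
  rw [← eLpNorm_two_sq, ← eLpNorm_two_sq]
  have h2 : eLpNorm (sgrad φ) 2 (vol Ω) ≤ ∑ i, eLpNorm (pderiv i φ) 2 (vol Ω) :=
    eLpNorm_vector_le (continuous_sgrad hφ).aestronglyMeasurable
  calc _ ≤ (eLpNorm φ 2 (vol Ω) + eLpNorm (sgrad φ) 2 (vol Ω)) ^ 2 := by
        rw [add_sq]
        gcongr
        exact le_self_add
    _ ≤ _ := by rw [energy]; gcongr

theorem energy_ne_top {φ : Space d → ℂ} (hφ : ContDiff ℝ ∞ φ) (hs : HasCompactSupport φ) :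
    energy Ω φ ≠ ⊤ :=
  ENNReal.add_ne_top.2 ⟨((hφ.continuous.memLp_of_hasCompactSupport hs).restrict Ω).2.ne,
    ENNReal.sum_ne_top.2 fun i _ => (((continuous_pderiv hφ i).memLp_of_hasCompactSupport
      (hs.fderiv_apply ℝ _)).restrict Ω).2.ne⟩

/-- The `H¹` distance of a smooth function to `u`. -/
noncomputable def energyDist (u : H1 Ω) (φ : Space d → ℂ) : ℝ≥0∞ :=
  eLpNorm (fun x => φ x - val u x) 2 (vol Ω) +
    ∑ i, eLpNorm (fun x => pderiv i φ x - grad u x i) 2 (vol Ω)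

theorem IsSmoothApprox.tendsto_energyDist {φ : ℕ → Space d → ℂ} {u : H1 Ω}
    (hφ : IsSmoothApprox φ u) : Tendsto (fun k => energyDist u (φ k)) atTop (𝓝 0) := by
  have := hφ.3.add (tendsto_finsetSum Finset.univ fun i _ => hφ.4 i)
  simpa [energyDist] using this

theorem eLpNorm_le_sub_add {α E : Type*} [MeasurableSpace α] [NormedAddCommGroup E] {μ : Measure α}
    {f g : α → E} (hf : AEStronglyMeasurable f μ) (hg : AEStronglyMeasurable g μ) :
    eLpNorm f 2 μ ≤ eLpNorm (fun x => f x - g x) 2 μ + eLpNorm g 2 μ := by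
  refine le_trans (le_of_eq ?_) (eLpNorm_add_le (hf.sub hg) hg (by norm_num))
  congr 1
  ext x
  simp

theorem eLpNorm_sub_le_sub_add_sub {α E : Type*} [MeasurableSpace α] [NormedAddCommGroup E]
    {μ : Measure α} {f g h : α → E} (hf : AEStronglyMeasurable f μ) (hg : AEStronglyMeasurable g μ)
    (hh : AEStronglyMeasurable h μ) :
    eLpNorm (fun x => f x - g x) 2 μ ≤
      eLpNorm (fun x => f x - h x) 2 μ + eLpNorm (fun x => g x - h x) 2 μ := by
  refine le_trans (le_of_eq ?_) (eLpNorm_sub_le (hf.sub hh) (hg.sub hh) (by norm_num))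
  congr 1
  ext x
  simp

theorem energy_le {φ : Space d → ℂ} (hφ : ContDiff ℝ ∞ φ) (u : H1 Ω) :
    energy Ω φ ≤ energyDist u φ + (d + 1 : ℝ≥0) * ‖u‖ₑ := by
  have h1 : energy Ω φ ≤ energyDist u φ +
      (eLpNorm (val u) 2 (vol Ω) + ∑ i, eLpNorm (fun x => grad u x i) 2 (vol Ω)) := by
    rw [energy, energyDist, add_add_add_comm, ← Finset.sum_add_distrib]
    gcongr with i
    · exact eLpNorm_le_sub_add hφ.continuous.aestronglyMeasurable (memLp_val u).1
    · exact eLpNorm_le_sub_add (continuous_pderiv hφ i).aestronglyMeasurable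
        (memLp_coord (memLp_grad u) i).1
  refine h1.trans ?_
  gcongr
  calc _ ≤ ‖u‖ₑ + ∑ _i : Fin d, ‖u‖ₑ := by
        gcongr with i
        · exact enorm_val_le u
        · exact enorm_grad_apply_le u i
    _ = _ := by simp; ring

theorem energy_sub_le {φ ψ : Space d → ℂ} (hφ : ContDiff ℝ ∞ φ) (hψ : ContDiff ℝ ∞ ψ) (u : H1 Ω) :
    energy Ω (fun x => φ x - ψ x) ≤ energyDist u φ + energyDist u ψ := by
  rw [energy, energyDist, energyDist, add_add_add_comm, ← Finset.sum_add_distrib]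
  gcongr with i
  · exact eLpNorm_sub_le_sub_add_sub hφ.continuous.aestronglyMeasurable
      hψ.continuous.aestronglyMeasurable (memLp_val u).1
  · have : pderiv i (fun x => φ x - ψ x) = fun x => pderiv i φ x - pderiv i ψ x :=
      funext (pderiv_sub hφ hψ i)
    rw [this]
    exact eLpNorm_sub_le_sub_add_sub (continuous_pderiv hφ i).aestronglyMeasurable
      (continuous_pderiv hψ i).aestronglyMeasurable (memLp_coord (memLp_grad u) i).1

/-- The trace inequality applied to differences makes the boundary values of an approximating
sequence Cauchy in `L²(∂Ω)`. -/
theorem IsBoundedLipschitzDomain.exists_isTrace (hΩ : IsBoundedLipschitzDomain Ω) (u : H1 Ω) :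
    ∃ γ, IsTrace u γ := by
  obtain ⟨C, hC⟩ := hΩ.exists_eLpNorm_surf_le
  obtain ⟨φ, hφ⟩ := hΩ.exists_isSmoothApprox u
  have hm : ∀ k, MemLp (φ k) 2 (surf Ω) := fun k =>
    ⟨(hφ.1 k).continuous.aestronglyMeasurable, (hC _ (hφ.1 k)).trans_lt
      (ENNReal.mul_lt_top (by simp) (energy_ne_top (hφ.1 k) (hφ.2 k)).lt_top)⟩
  have hcauchy : CauchySeq fun k => (hm k).toLp (φ k) := by
    rw [EMetric.cauchySeq_iff]
    intro ε hε
    have ht := ENNReal.Tendsto.const_mul (a := (C : ℝ≥0∞)) hφ.tendsto_energyDist (Or.inr (by simp))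
    rw [mul_zero] at ht
    obtain ⟨N, hN⟩ := eventually_atTop.1 (ht.eventually_lt_const (ENNReal.half_pos hε.ne'))
    refine ⟨N, fun m hmN n hnN => ?_⟩
    rw [Lp.edist_toLp_toLp]
    calc eLpNorm (φ m - φ n) 2 (surf Ω) ≤ C * energy Ω (fun x => φ m x - φ n x) :=
          hC _ ((hφ.1 m).sub (hφ.1 n))
      _ ≤ C * (energyDist u (φ m) + energyDist u (φ n)) := by
          gcongr; exact energy_sub_le (hφ.1 m) (hφ.1 n) u
      _ < ε := by
          rw [mul_add, ← ENNReal.add_halves ε]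
          exact ENNReal.add_lt_add (hN m hmN) (hN n hnN)
  obtain ⟨γ, hγ⟩ := cauchySeq_tendsto_of_complete hcauchy
  refine ⟨γ, isTrace_iff.2 ⟨φ, hφ, ?_⟩⟩
  refine (tendsto_iff_edist_tendsto_0.1 hγ).congr fun k => ?_
  rw [Lp.edist_def]
  refine eLpNorm_congr_ae ((hm k).coeFn_toLp.mono fun x hx => ?_)
  simp [hx]

/-- The smooth inequality passes to the limit. It is proved for every trace, not only a chosen one,
so that uniqueness can be read off. -/
theorem IsBoundedLipschitzDomain.exists_enorm_trace_le (hΩ : IsBoundedLipschitzDomain Ω) :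
    ∃ C : ℝ≥0, ∀ (u : H1 Ω) (γ : Lp ℂ 2 (surf Ω)), IsTrace u γ → ‖γ‖ ≤ C * ‖u‖ := by
  obtain ⟨C, hC⟩ := hΩ.exists_eLpNorm_surf_le
  refine ⟨C * (d + 1), fun u γ hγ => ?_⟩
  obtain ⟨φ, hφ, hφγ⟩ := isTrace_iff.1 hγ
  have hk : ∀ k, ‖γ‖ₑ ≤ eLpNorm (fun x => φ k x - γ x) 2 (surf Ω) +
      C * (energyDist u (φ k) + (d + 1 : ℝ≥0) * ‖u‖ₑ) := by
    intro k
    have h1 := eLpNorm_le_sub_add (Lp.memLp γ).1 (hφ.1 k).continuous.aestronglyMeasurable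
    rw [Lp.enorm_def]
    refine h1.trans (add_le_add (le_of_eq ?_) ?_)
    · rw [← eLpNorm_neg]; congr 1; ext x; simp
    · refine (hC _ (hφ.1 k)).trans ?_
      gcongr
      exact energy_le (hφ.1 k) u
  have hlim := hφγ.add (ENNReal.Tendsto.const_mul (a := (C : ℝ≥0∞))
    (hφ.tendsto_energyDist.add_const (((d + 1 : ℝ≥0) : ℝ≥0∞) * ‖u‖ₑ)) (Or.inr (by simp)))
  have h2 := ge_of_tendsto' hlim hk
  rw [zero_add, zero_add, ← mul_assoc, ← ENNReal.coe_mul, ← ofReal_norm, ← ofReal_norm,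
    ← ENNReal.ofReal_coe_nnreal, ← ENNReal.ofReal_mul (by positivity),
    ENNReal.ofReal_le_ofReal_iff (by positivity)] at h2
  exact h2

theorem IsBoundedLipschitzDomain.existsUnique_isTrace (hΩ : IsBoundedLipschitzDomain Ω)
    (u : H1 Ω) : ∃! γ, IsTrace u γ := by
  obtain ⟨γ, hγ⟩ := hΩ.exists_isTrace u
  obtain ⟨C, hC⟩ := hΩ.exists_enorm_trace_le
  refine ⟨γ, hγ, fun δ hδ => ?_⟩
  -- The difference of two traces of `u` is a trace of zero.
  have h := hC _ _ (hδ.add (hγ.smul (-1)))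
  rw [neg_one_smul, neg_one_smul, add_neg_cancel, norm_zero, mul_zero] at h
  rw [← sub_eq_zero, sub_eq_add_neg]
  exact norm_le_zero_iff.1 h

theorem IsBoundedLipschitzDomain.isTrace_trace (hΩ : IsBoundedLipschitzDomain Ω) (u : H1 Ω) :
    IsTrace u (trace u) := by
  rw [trace, dif_pos (hΩ.exists_isTrace u)]
  exact (hΩ.exists_isTrace u).choose_spec

/-- The trace is a bounded linear operator. -/
theorem IsBoundedLipschitzDomain.exists_traceL (hΩ : IsBoundedLipschitzDomain Ω) :
    ∃ γ : H1 Ω →L[ℂ] Lp ℂ 2 (surf Ω), ∀ u, γ u = trace u := by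
  obtain ⟨C, hC⟩ := hΩ.exists_enorm_trace_le
  let L : H1 Ω →ₗ[ℂ] Lp ℂ 2 (surf Ω) :=
    { toFun := trace
      map_add' := fun u v => (hΩ.existsUnique_isTrace (u + v)).unique (hΩ.isTrace_trace _)
        ((hΩ.isTrace_trace u).add (hΩ.isTrace_trace v))
      map_smul' := fun c u => (hΩ.existsUnique_isTrace (c • u)).unique (hΩ.isTrace_trace _)
        ((hΩ.isTrace_trace u).smul c) }
  exact ⟨L.mkContinuous C fun u => hC u _ (hΩ.isTrace_trace u), fun u => rfl⟩

end Trace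

/-! ### Completeness of H¹ -/

section Functionals

variable {α : Type*} [MeasurableSpace α] {μ : Measure α}

theorem exists_integralL {f : α → ℝ} (hf : MemLp f 2 μ) :
    ∃ L : Lp ℂ 2 μ →L[ℂ] ℂ, ∀ u : Lp ℂ 2 μ, L u = ∫ x, f x • u x ∂μ := by
  have hf' : MemLp (fun x => (f x : ℂ)) 2 μ := hf.ofReal
  refine ⟨innerSL ℂ (hf'.toLp _), fun u => ?_⟩
  rw [innerSL_apply_apply, L2.inner_def]
  refine integral_congr_ae (hf'.coeFn_toLp.mono fun x hx => ?_)
  simp [hx, mul_comm]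

end Functionals

section Complete

variable {d : ℕ} {Ω : Set (Space d)}

/-- Each test function imposes an equation between functionals continuous on `L²`, so the space is
an intersection of closed sets. -/
theorem isClosed_H1 : IsClosed (H1 Ω : Set
    (WithLp 2 (Lp ℂ 2 (vol Ω) × Lp (EuclideanSpace ℂ (Fin d)) 2 (vol Ω)))) := by
  have h : (H1 Ω : Set (WithLp 2 (Lp ℂ 2 (vol Ω) × Lp (EuclideanSpace ℂ (Fin d)) 2 (vol Ω)))) =
      ⋂ (φ : Space d → ℝ) (_ : IsTestFunction Ω φ) (i : Fin d),
        {p | ∫ x, pderiv i φ x • p.fst x ∂(vol Ω) = - ∫ x, φ x • p.snd x i ∂(vol Ω)} := by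
    ext p
    simp only [Set.mem_iInter]
    rfl
  rw [h]
  refine isClosed_iInter fun φ => isClosed_iInter fun hφ => isClosed_iInter fun i => ?_
  obtain ⟨L₁, h₁⟩ := exists_integralL (hφ.memLp_pderiv i)
  obtain ⟨L₂, h₂⟩ := exists_integralL hφ.memLp
  let p : EuclideanSpace ℂ (Fin d) →L[ℂ] ℂ := EuclideanSpace.proj i
  have h₃ : ∀ G : Lp (EuclideanSpace ℂ (Fin d)) 2 (vol Ω),
      ∫ x, φ x • G x i ∂(vol Ω) = L₂ (p.compLpL 2 (vol Ω) G) := fun G => by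
    rw [h₂]
    refine integral_congr_ae ((p.coeFn_compLpL G).mono fun x hx => ?_)
    simp only [hx]
    rfl
  simp only [← h₁, h₃]
  exact isClosed_eq (L₁.continuous.comp (WithLp.continuous_fst ..))
    ((L₂.continuous.comp ((p.compLpL 2 (vol Ω)).continuous.comp (WithLp.continuous_snd ..))).neg)

instance : CompleteSpace (H1 Ω) := isClosed_H1.completeSpace_coe

/-- The embedding of `H¹(Ω)` in `L²(Ω)`. -/
noncomputable def valL (Ω : Set (Space d)) : H1 Ω →L[ℂ] Lp ℂ 2 (vol Ω) :=
  (WithLp.fstL 2 ℂ _ _).comp (H1 Ω).subtypeL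

/-- The weak gradient as an operator on `H¹(Ω)`. -/
noncomputable def gradL (Ω : Set (Space d)) :
    H1 Ω →L[ℂ] Lp (EuclideanSpace ℂ (Fin d)) 2 (vol Ω) :=
  (WithLp.sndL 2 ℂ _ _).comp (H1 Ω).subtypeL

theorem coe_valL (u : H1 Ω) : ⇑(valL Ω u) = val u := rfl

theorem coe_gradL (u : H1 Ω) : ⇑(gradL Ω u) = grad u := rfl

theorem norm_sq_eq (u : H1 Ω) : ‖u‖ ^ 2 = ‖valL Ω u‖ ^ 2 + ‖gradL Ω u‖ ^ 2 :=
  WithLp.prod_norm_sq_eq_of_L2 u.1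

end Complete

/-! ### A compactness criterion -/

section Compactness

/-- Let `P` project onto the orthogonal complement of the kernel of `L`. That complement is
finite-dimensional, since `L` is injective on it, so `T P` has finite rank, and `T - T P` has norm
at most `η`. Compact operators are closed under norm limits. -/
theorem isCompactOperator_of_forall_exists {E F : Type*} [NormedAddCommGroup E]
    [InnerProductSpace ℂ E] [CompleteSpace E] [NormedAddCommGroup F] [NormedSpace ℂ F]
    [CompleteSpace F] (T : E →L[ℂ] F)
    (h : ∀ η : ℝ, 0 < η → ∃ (ι : Type) (_ : Finite ι) (L : E →ₗ[ℂ] (ι → ℂ)),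
      Continuous L ∧ ∀ u, L u = 0 → ‖T u‖ ≤ η * ‖u‖) : IsCompactOperator T := by
  choose ι _ L hLc hL using fun k : ℕ => h (1 / ((k : ℝ) + 1)) (by positivity)
  let N : ℕ → Submodule ℂ E := fun k => LinearMap.ker (L k)
  have hNc : ∀ k, IsClosed (N k : Set E) := fun k => isClosed_singleton.preimage (hLc k)
  have : ∀ k, CompleteSpace (N k) := fun k => (hNc k).completeSpace_coe
  have hfin : ∀ k, FiniteDimensional ℂ (N k)ᗮ := fun k => by
    refine Module.Finite.of_injective ((L k).comp (N k)ᗮ.subtype)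
      ((injective_iff_map_eq_zero _).2 fun x hx => ?_)
    have h1 : (x : E) ∈ N k := hx
    have h2 := Submodule.inner_right_of_mem_orthogonal h1 x.2
    exact Subtype.ext (inner_self_eq_zero.1 h2)
  let P : ℕ → E →L[ℂ] E := fun k => (N k)ᗮ.starProjection
  refine isCompactOperator_of_tendsto (F := fun k => T.comp (P k)) (l := atTop) ?_
    (Eventually.of_forall fun k => ?_)
  · rw [tendsto_iff_norm_sub_tendsto_zero]
    refine squeeze_zero (fun _ => norm_nonneg _) (fun k => ?_)
      tendsto_one_div_add_atTop_nhds_zero_nat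
    refine ContinuousLinearMap.opNorm_le_bound _ (by positivity) fun u => ?_
    have h1 : (T.comp (P k) - T) u = -T ((N k).starProjection u) := by
      have h2 := (N k).starProjection_add_starProjection_orthogonal u
      have h3 : T u = T ((N k).starProjection u) + T (P k u) := by rw [← map_add, h2]
      rw [sub_apply, h3]
      simp
    rw [h1, norm_neg]
    refine (hL k _ (LinearMap.mem_ker.1 (Submodule.starProjection_apply_mem (N k) u))).trans ?_
    gcongr
    exact Submodule.norm_starProjection_apply_le _ _
  · have h1 : IsCompactOperator ((T.comp (N k)ᗮ.subtypeL)) :=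
      have := FiniteDimensional.proper ℂ (N k)ᗮ
      isCompactOperator_of_locallyCompactSpace_rng (T.comp (N k)ᗮ.subtypeL)
    exact h1.comp_clm (N k)ᗮ.orthogonalProjectionOnto

end Compactness

/-! ### The translation estimate in H¹ -/

section Translation

variable {d : ℕ} {Ω : Set (Space d)}

theorem setLIntegral_translate_le {h : Space d → ℝ≥0∞} {A : Set (Space d)} (hA : MeasurableSet A)
    (hΩ : MeasurableSet Ω) (v : Space d) (hv : ∀ y ∈ A, y + v ∈ Ω) :
    ∫⁻ y in A, h (y + v) ≤ ∫⁻ y in Ω, h y := by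
  rw [← lintegral_indicator hA, ← lintegral_indicator hΩ,
    ← lintegral_add_right_eq_self (Ω.indicator h) v]
  refine lintegral_mono fun y => ?_
  by_cases hy : y ∈ A
  · rw [Set.indicator_of_mem hy, Set.indicator_of_mem (hv y hy)]
  · rw [Set.indicator_of_notMem hy]; exact zero_le

theorem eLpNorm_translate_le {E : Type*} [NormedAddCommGroup E] {h : Space d → E}
    {A : Set (Space d)} (hA : MeasurableSet A) (hΩ : MeasurableSet Ω) (v : Space d)
    (hv : ∀ y ∈ A, y + v ∈ Ω) :
    eLpNorm (fun y => h (y + v)) 2 (vol A) ≤ eLpNorm h 2 (vol Ω) := by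
  rw [eLpNorm_two_le_iff, eLpNorm_two_sq]
  exact setLIntegral_translate_le (h := fun y => ‖h y‖ₑ ^ 2) hA hΩ v hv

theorem eLpNorm_translate_sub_le_of_contDiff {φ : Space d → ℂ} (hφ : ContDiff ℝ ∞ φ)
    {A : Set (Space d)} (hA : MeasurableSet A) (hΩ : MeasurableSet Ω) (v : Space d)
    (hv : ∀ y ∈ A, ∀ s ∈ Set.Ioc (0 : ℝ) 1, y + s • v ∈ Ω) :
    eLpNorm (fun y => φ (y + v) - φ y) 2 (vol A) ≤ ‖v‖ₑ * eLpNorm (sgrad φ) 2 (vol Ω) := by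
  rw [eLpNorm_two_le_iff, mul_pow, eLpNorm_two_sq]
  have hm : Measurable fun p : Space d × ℝ => ‖sgrad φ (p.1 + p.2 • v)‖ₑ ^ 2 :=
    ((continuous_sgrad hφ).comp
      (by fun_prop : Continuous fun p : Space d × ℝ => p.1 + p.2 • v)).enorm.measurable.pow_const 2
  calc _ ≤ ∫⁻ y in A, ‖v‖ₑ ^ 2 * ∫⁻ s in Set.Ioc (0 : ℝ) 1, ‖sgrad φ (y + s • v)‖ₑ ^ 2 := by
        refine lintegral_mono fun y => ?_
        simpa using enorm_sub_sq_le_lintegral_sgrad hφ y v (τ := 1) (by simp)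
    _ = ‖v‖ₑ ^ 2 * ∫⁻ s in Set.Ioc (0 : ℝ) 1, (∫⁻ y in A, ‖sgrad φ (y + s • v)‖ₑ ^ 2) := by
        rw [lintegral_const_mul _ hm.lintegral_prod_right',
          lintegral_lintegral_swap hm.aemeasurable]
    _ ≤ ‖v‖ₑ ^ 2 * ∫⁻ s in Set.Ioc (0 : ℝ) 1, (∫⁻ y in Ω, ‖sgrad φ y‖ₑ ^ 2) := by
        refine mul_le_mul' le_rfl ?_
        exact setLIntegral_mono' measurableSet_Ioc fun s hs =>
          setLIntegral_translate_le (h := fun y => ‖sgrad φ y‖ₑ ^ 2) hA hΩ (s • v)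
            fun y hy => hv y hy s hs
    _ = _ := by simp

/-- Tonelli gives this for smooth functions, because every translate of `A` along the segment stays
in `Ω`; density carries it over to `u`. -/
theorem eLpNorm_translate_sub_le (hΩ : IsBoundedLipschitzDomain Ω) (u : H1 Ω) {A : Set (Space d)}
    (hA : MeasurableSet A) (hAΩ : A ⊆ Ω) (v : Space d)
    (hv : ∀ y ∈ A, ∀ s ∈ Set.Ioc (0 : ℝ) 1, y + s • v ∈ Ω) :
    eLpNorm (fun y => val u (y + v) - val u y) 2 (vol A) ≤
      ‖v‖ₑ * eLpNorm (grad u) 2 (vol Ω) := by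
  obtain ⟨φ, hφ⟩ := hΩ.exists_isSmoothApprox u
  have hΩm := hΩ.1.measurableSet
  have hv1 : ∀ y ∈ A, y + v ∈ Ω := fun y hy => by simpa using hv y hy 1 (by simp)
  have hcv : Continuous fun y : Space d => y + v := by fun_prop
  have hu := stronglyMeasurable_val u
  have hk : ∀ k, eLpNorm (fun y => val u (y + v) - val u y) 2 (vol A) ≤
      ‖v‖ₑ * (energyDist u (φ k) + eLpNorm (grad u) 2 (vol Ω)) +
        (energyDist u (φ k) + energyDist u (φ k)) := by
    intro k
    have hφk := (hφ.1 k).continuous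
    have hm : AEStronglyMeasurable (fun y => φ k y - val u y) (vol A) :=
      hφk.aestronglyMeasurable.sub hu.aestronglyMeasurable
    have hmv : AEStronglyMeasurable (fun y => φ k (y + v) - val u (y + v)) (vol A) :=
      (hφk.comp hcv).aestronglyMeasurable.sub (hu.comp_measurable hcv.measurable).aestronglyMeasurable
    have hmφ : AEStronglyMeasurable (fun y => φ k (y + v) - φ k y) (vol A) :=
      ((hφk.comp hcv).sub hφk).aestronglyMeasurable
    have e : (fun y => val u (y + v) - val u y) = (fun y => φ k (y + v) - φ k y) +
        ((fun y => φ k y - val u y) - fun y => φ k (y + v) - val u (y + v)) := by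
      ext y; simp only [Pi.add_apply, Pi.sub_apply]; ring
    have h1 : eLpNorm (fun y => φ k y - val u y) 2 (vol Ω) ≤ energyDist u (φ k) := le_self_add
    rw [e]
    refine (eLpNorm_add_le hmφ (hm.sub hmv) (by norm_num)).trans
      (add_le_add ?_ ((eLpNorm_sub_le hm hmv (by norm_num)).trans (add_le_add ?_ ?_)))
    · refine (eLpNorm_translate_sub_le_of_contDiff (hφ.1 k) hA hΩm v hv).trans ?_
      gcongr
      refine (eLpNorm_le_sub_add (continuous_sgrad (hφ.1 k)).aestronglyMeasurable
        (memLp_grad u).1).trans ?_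
      gcongr
      exact (eLpNorm_vector_le ((continuous_sgrad (hφ.1 k)).aestronglyMeasurable.sub
        (memLp_grad u).1)).trans le_add_self
    · exact (eLpNorm_mono_measure _ (Measure.restrict_mono hAΩ le_rfl)).trans h1
    · exact (eLpNorm_translate_le (h := fun y => φ k y - val u y) hA hΩm v hv1).trans h1
  have ht := hφ.tendsto_energyDist
  have hlim := (ENNReal.Tendsto.const_mul (a := ‖v‖ₑ)
    (ht.add_const (eLpNorm (grad u) 2 (vol Ω))) (Or.inr (by simp))).add (ht.add ht)
  simpa using ge_of_tendsto' hlim hk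

end Translation

/-! ### Rellich's compactness theorem -/

section Rellich

variable {d : ℕ} {Ω : Set (Space d)}

/-- The extension of `u` by zero. -/
noncomputable def zeroExt (u : H1 Ω) : Space d → ℂ := Ω.indicator (val u)

theorem memLp_zeroExt (hΩ : IsOpen Ω) (u : H1 Ω) : MemLp (zeroExt u) 2 volume :=
  (memLp_indicator_iff_restrict hΩ.measurableSet).2 (memLp_val u)

theorem stronglyMeasurable_zeroExt (hΩ : IsOpen Ω) (u : H1 Ω) : StronglyMeasurable (zeroExt u) :=
  (stronglyMeasurable_val u).indicator hΩ.measurableSet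

theorem eLpNorm_mollify_sub_le (hΩ : IsBoundedLipschitzDomain Ω) {U : Set (Space d)}
    (hU : MeasurableSet U) {n : Space d} {c : ℝ} (hcone : IsConeNhd Ω U n c)
    {t : ℝ} (ht : t ∈ Set.Ioc (0 : ℝ) 1) {ρ : Space d → ℝ}
    (hρ : IsMollifier ρ (Metric.closedBall (-(t • n)) (t * c))) (u : H1 Ω) :
    eLpNorm (fun y => mollify ρ (zeroExt u) y - val u y) 2 (vol (Ω ∩ U)) ≤
      ENNReal.ofReal (t * (‖n‖ + c)) * ‖u‖ₑ := by
  have hA : MeasurableSet (Ω ∩ U) := hΩ.1.measurableSet.inter hU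
  have e : eLpNorm (fun y => mollify ρ (zeroExt u) y - val u y) 2 (vol (Ω ∩ U)) =
      eLpNorm (fun y => mollify ρ (zeroExt u) y - zeroExt u y) 2 (vol (Ω ∩ U)) := by
    refine eLpNorm_congr_ae ((ae_restrict_mem hA).mono fun y hy => ?_)
    simp only [zeroExt, Set.indicator_of_mem hy.1]
  rw [e, eLpNorm_two_le_iff]
  refine hρ.lintegral_mollify_sub_le ((memLp_zeroExt hΩ.1 u).locallyIntegrable (by norm_num))
    (stronglyMeasurable_zeroExt hΩ.1 u) _ fun w hw => ?_
  have hwn : ‖-w - t • n‖ ≤ t * c := by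
    rw [mem_closedBall_iff_norm] at hw
    rwa [← norm_neg, show -(-w - t • n) = w - -(t • n) by abel]
  have hv : ∀ y ∈ Ω ∩ U, ∀ s ∈ Set.Ioc (0 : ℝ) 1, y + s • (-w) ∈ Ω := by
    intro y hy s hs
    -- The whole segment from `y` to `y - w` lies in the cone: its point at parameter `s` belongs to
    -- the cone ball at height `s * t`.
    refine hcone y hy (s * t) ⟨mul_pos hs.1 ht.1, mul_le_one₀ hs.2 ht.1.le ht.2⟩ ?_
    rw [mem_closedBall_iff_norm, show y + s • (-w) - (y + (s * t) • n) = s • (-w - t • n) by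
      rw [mul_smul, smul_sub]; abel, norm_smul, Real.norm_of_nonneg hs.1.le, mul_assoc]
    gcongr
    exact hs.1.le
  have h1 := eLpNorm_translate_sub_le hΩ u hA Set.inter_subset_left (-w) hv
  rw [← eLpNorm_two_le_iff]
  refine le_trans (le_of_eq ?_) (h1.trans (mul_le_mul' ?_ (enorm_grad_le u)))
  · refine eLpNorm_congr_ae ((ae_restrict_mem hA).mono fun y hy => ?_)
    have hyw : y - w ∈ Ω := by simpa [sub_eq_add_neg] using hv y hy 1 (by simp)
    simp only [zeroExt, Set.indicator_of_mem hy.1, Set.indicator_of_mem hyw]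
    rw [← sub_eq_add_neg]
  · rw [← ofReal_norm]
    refine ENNReal.ofReal_le_ofReal ?_
    have h2 := norm_add_le (-w - t • n) (t • n)
    rw [sub_add_cancel, norm_smul, Real.norm_of_nonneg ht.1.le] at h2
    linarith

theorem exists_mollifyL (hΩ : IsOpen Ω) {ρ : Space d → ℝ} {S : Set (Space d)}
    (hρ : IsMollifier ρ S) (y : Space d) :
    ∃ L : H1 Ω →L[ℂ] ℂ, ∀ u, L u = mollify ρ (zeroExt u) y := by
  have hc : Continuous fun z => ρ (y - z) :=
    hρ.contDiff.continuous.comp (continuous_const.sub continuous_id)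
  have hs : HasCompactSupport fun z => ρ (y - z) := by
    have := hρ.hasCompactSupport.comp_homeomorph (Homeomorph.subLeft y)
    exact this
  obtain ⟨L, hL⟩ := exists_integralL ((hc.memLp_of_hasCompactSupport (p := 2) (μ := volume)
    hs).restrict Ω)
  refine ⟨L.comp (valL Ω), fun u => ?_⟩
  rw [ContinuousLinearMap.comp_apply, hL, mollify_apply', ← integral_indicator hΩ.measurableSet]
  refine integral_congr_ae (Eventually.of_forall fun z => ?_)
  by_cases hz : z ∈ Ω <;> simp [zeroExt, hz, coe_valL]

/-- Equicontinuity of the mollifications: the oscillation of `ρ` is multiplied by the `L¹` norm of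
`u`, which Cauchy-Schwarz bounds on the finite measure space `Ω`. -/
theorem enorm_mollify_sub_mollify_le (hΩ : IsOpen Ω) {ρ : Space d → ℝ} {S : Set (Space d)}
    (hρ : IsMollifier ρ S) (u : H1 Ω) (y y' : Space d) {ε : ℝ}
    (h : ∀ z, |ρ (y - z) - ρ (y' - z)| ≤ ε) :
    ‖mollify ρ (zeroExt u) y - mollify ρ (zeroExt u) y'‖ₑ ≤
      ENNReal.ofReal ε * (‖u‖ₑ * volume Ω ^ (1 / 2 : ℝ)) := by
  have hi : ∀ y, Integrable fun z => ρ (y - z) • zeroExt u z := fun y => by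
    have := (hρ.integrable_smul
      ((memLp_zeroExt hΩ u).locallyIntegrable (by norm_num)) y).comp_sub_left y
    simpa using this
  rw [mollify_apply', mollify_apply', ← integral_sub (hi y) (hi y')]
  refine (enorm_integral_le_lintegral_enorm _).trans ?_
  calc _ ≤ ∫⁻ z, ENNReal.ofReal ε * ‖zeroExt u z‖ₑ := by
        refine lintegral_mono fun z => ?_
        rw [← sub_smul, enorm_smul]
        gcongr
        rw [← ofReal_norm]
        exact ENNReal.ofReal_le_ofReal (h z)
    _ = ENNReal.ofReal ε * ∫⁻ z in Ω, ‖val u z‖ₑ := by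
        rw [lintegral_const_mul _ (stronglyMeasurable_zeroExt hΩ u).enorm,
          ← lintegral_indicator hΩ.measurableSet]
        congr 1
        refine lintegral_congr fun z => ?_
        by_cases hz : z ∈ Ω <;> simp [zeroExt, hz]
    _ ≤ _ := by
        gcongr
        rw [← eLpNorm_one_eq_lintegral_enorm]
        refine (eLpNorm_le_eLpNorm_mul_rpow_measure_univ (q := 2) (by norm_num)
          (memLp_val u).1).trans ?_
        rw [Measure.restrict_apply_univ]
        norm_num
        gcongr
        exact enorm_val_le u

/-- On each cone neighbourhood, the `L²` norm is small compared to the `H¹` norm on a subspace of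
finite codimension. -/
theorem IsConeNhd.exists_functionals (hΩ : IsBoundedLipschitzDomain Ω) {U : Set (Space d)}
    (hU : MeasurableSet U) {n : Space d} {c : ℝ} (hc : 0 < c) (hcone : IsConeNhd Ω U n c)
    {η : ℝ} (hη : 0 < η) :
    ∃ (ι : Type) (_ : Finite ι) (L : H1 Ω →L[ℂ] (ι → ℂ)), ∀ u, L u = 0 →
      eLpNorm (val u) 2 (vol (Ω ∩ U)) ≤ ENNReal.ofReal η * ‖u‖ₑ := by
  have hnc : 0 < ‖n‖ + c := by positivity
  obtain ⟨t, ht, htη⟩ : ∃ t ∈ Set.Ioc (0 : ℝ) 1, t * (‖n‖ + c) ≤ η / 2 := by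
    refine ⟨min 1 (η / 2 / (‖n‖ + c)), ⟨by positivity, min_le_left _ _⟩, ?_⟩
    calc _ ≤ η / 2 / (‖n‖ + c) * (‖n‖ + c) := by gcongr; exact min_le_right _ _
      _ = η / 2 := by field_simp
  obtain ⟨ρ, hρ⟩ := exists_isMollifier (-(t • n)) (mul_pos ht.1 hc)
  have hvol : volume Ω ≠ ⊤ := hΩ.2.1.measure_lt_top.ne
  set m := (volume Ω).toReal with hm
  have hm0 : 0 ≤ m := ENNReal.toReal_nonneg
  -- The sup bound carries one factor `|Ω|^(1/2)` and its `L²` norm another, and `ε m ≤ η / 2`; the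
  -- `+ 1` avoids division by zero.
  set ε := η / 2 / (m + 1) with hε
  have hε0 : 0 < ε := by positivity
  obtain ⟨δ, hδ, hδρ⟩ := Metric.uniformContinuous_iff.1
    (hρ.hasCompactSupport.uniformContinuous_of_continuous hρ.contDiff.continuous) ε hε0
  -- The functionals are the values of the mollification on a finite `δ`-net. When these vanish,
  -- equicontinuity makes the mollification small on all of `Ω`.
  obtain ⟨s, hs, hsΩ⟩ := Metric.totallyBounded_iff.1
    (hΩ.2.1.isCompact_closure.totallyBounded.subset subset_closure) δ hδ
  choose L hL using fun y : s => exists_mollifyL hΩ.1 hρ (y : Space d)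
  refine ⟨s, hs.to_subtype, ContinuousLinearMap.pi L, fun u hu => ?_⟩
  have hmol : ∀ y ∈ Ω ∩ U, ‖mollify ρ (zeroExt u) y‖ₑ ≤
      ENNReal.ofReal ε * (‖u‖ₑ * volume Ω ^ (1 / 2 : ℝ)) := by
    intro y hy
    obtain ⟨y', hy', hyy'⟩ := Set.mem_iUnion₂.1 (hsΩ hy.1)
    have h0 : mollify ρ (zeroExt u) y' = 0 := by
      rw [← hL ⟨y', hy'⟩]
      exact congrFun hu ⟨y', hy'⟩
    have h1 := enorm_mollify_sub_mollify_le hΩ.1 hρ u y y' (ε := ε) fun z => by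
      rw [← Real.dist_eq]
      exact (hδρ (by simpa using hyy')).le
    rwa [h0, sub_zero] at h1
  have hA : MeasurableSet (Ω ∩ U) := hΩ.1.measurableSet.inter hU
  have h2 : eLpNorm (mollify ρ (zeroExt u)) 2 (vol (Ω ∩ U)) ≤ ENNReal.ofReal (η / 2) * ‖u‖ₑ := by
    refine (eLpNorm_le_of_ae_enorm_bound ((ae_restrict_mem hA).mono hmol)).trans ?_
    rw [Measure.restrict_apply_univ, smul_eq_mul]
    have h3 : volume (Ω ∩ U) ^ (ENNReal.toReal 2)⁻¹ ≤ volume Ω ^ (1 / 2 : ℝ) := by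
      norm_num
      gcongr
      exact Set.inter_subset_left
    have h4 : volume Ω ^ (1 / 2 : ℝ) * volume Ω ^ (1 / 2 : ℝ) = ENNReal.ofReal m := by
      rw [← ENNReal.rpow_add_of_nonneg _ _ (by norm_num) (by norm_num), hm,
        ENNReal.ofReal_toReal hvol]
      norm_num
    calc _ ≤ ENNReal.ofReal ε * (‖u‖ₑ * volume Ω ^ (1 / 2 : ℝ)) * volume Ω ^ (1 / 2 : ℝ) := by
          gcongr
      _ = ENNReal.ofReal (ε * m) * ‖u‖ₑ := by
          rw [ENNReal.ofReal_mul hε0.le, ← h4]; ring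
      _ ≤ _ := by
          gcongr
          rw [hε, div_mul_eq_mul_div, div_le_iff₀ (by positivity)]
          nlinarith
  have hmm : AEStronglyMeasurable (mollify ρ (zeroExt u)) (vol (Ω ∩ U)) :=
    (hρ.contDiff_mollify ((memLp_zeroExt hΩ.1 u).locallyIntegrable
      (by norm_num))).continuous.aestronglyMeasurable
  have hmu : AEStronglyMeasurable (val u) (vol (Ω ∩ U)) :=
    (stronglyMeasurable_val u).aestronglyMeasurable
  calc eLpNorm (val u) 2 (vol (Ω ∩ U))
      ≤ eLpNorm (fun y => val u y - mollify ρ (zeroExt u) y) 2 (vol (Ω ∩ U)) +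
        eLpNorm (mollify ρ (zeroExt u)) 2 (vol (Ω ∩ U)) := eLpNorm_le_sub_add hmu hmm
    _ ≤ ENNReal.ofReal (η / 2) * ‖u‖ₑ + ENNReal.ofReal (η / 2) * ‖u‖ₑ := by
        gcongr
        have h5 := eLpNorm_mollify_sub_le hΩ hU hcone ht hρ u
        rw [show (fun y => val u y - mollify ρ (zeroExt u) y) =
          -fun y => mollify ρ (zeroExt u) y - val u y by ext y; simp, eLpNorm_neg]
        refine h5.trans ?_
        gcongr
    _ = _ := by
        rw [← add_mul, ← ENNReal.ofReal_add (by positivity) (by positivity), add_halves]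

/-- Rellich's theorem: `H¹(Ω)` embeds compactly in `L²(Ω)`. -/
theorem IsBoundedLipschitzDomain.isCompactOperator_valL (hΩ : IsBoundedLipschitzDomain Ω) :
    IsCompactOperator (valL Ω) := by
  refine isCompactOperator_of_forall_exists _ fun η hη => ?_
  obtain ⟨ι, _, x, r, n, c, hcone, hcover⟩ := hΩ.exists_finite_cover
  set N := (Fintype.card ι : ℝ) with hN
  have hN0 : 0 ≤ N := Nat.cast_nonneg _
  -- With this tolerance the `N` squared local bounds sum to `N (η / (N + 1))² ≤ η²`.
  choose κ _ L hL using fun j => (hcone j).2.exists_functionals hΩ measurableSet_ball (hcone j).1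
    (show 0 < η / (N + 1) by positivity)
  let L' : H1 Ω →L[ℂ] ((Σ j, κ j) → ℂ) :=
    ContinuousLinearMap.pi fun p => (ContinuousLinearMap.proj p.2).comp (L p.1)
  refine ⟨Σ j, κ j, inferInstance, L', L'.continuous, fun u hu => ?_⟩
  have hj : ∀ j, L j u = 0 := fun j => funext fun k => congrFun hu ⟨j, k⟩
  have h1 : eLpNorm (val u) 2 (vol Ω) ≤ ENNReal.ofReal η * ‖u‖ₑ := by
    rw [eLpNorm_two_le_iff]
    calc ∫⁻ y in Ω, ‖val u y‖ₑ ^ 2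
        ≤ ∫⁻ y in ⋃ j, Ω ∩ Metric.ball (x j) (r j), ‖val u y‖ₑ ^ 2 := by
          refine lintegral_mono_set fun y hy => ?_
          obtain ⟨j, hj⟩ := Set.mem_iUnion.1 (hcover (subset_closure hy))
          exact Set.mem_iUnion.2 ⟨j, hy, hj⟩
      _ ≤ ∑ j, ∫⁻ y in Ω ∩ Metric.ball (x j) (r j), ‖val u y‖ₑ ^ 2 := by
          rw [← tsum_fintype (L := .unconditional _)]; exact lintegral_iUnion_le _ _
      _ ≤ ∑ _j : ι, (ENNReal.ofReal (η / (N + 1)) * ‖u‖ₑ) ^ 2 :=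
          Finset.sum_le_sum fun j _ => (eLpNorm_two_le_iff _ _ _).1 (hL j u (hj j))
      _ = ENNReal.ofReal (N * (η / (N + 1)) ^ 2) * ‖u‖ₑ ^ 2 := by
          rw [Finset.sum_const, nsmul_eq_mul, Finset.card_univ, mul_pow, ← mul_assoc,
            ENNReal.ofReal_mul hN0, ENNReal.ofReal_pow (by positivity), hN, ENNReal.ofReal_natCast]
      _ ≤ _ := by
          rw [mul_pow, ← ENNReal.ofReal_pow hη.le]
          gcongr
          rw [div_pow, mul_div_assoc', div_le_iff₀ (by positivity)]
          nlinarith [sq_nonneg η, mul_nonneg (sq_nonneg η) hN0, mul_nonneg (sq_nonneg η) (sq_nonneg N)]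
  rw [← coe_valL, ← Lp.enorm_def, ← ofReal_norm, ← ofReal_norm, ← ENNReal.ofReal_mul hη.le,
    ENNReal.ofReal_le_ofReal_iff (by positivity)] at h1
  exact h1

end Rellich

/-! ### Triangular systems of coercive operators -/

section Hilbert

variable {E : Type*} [NormedAddCommGroup E] [InnerProductSpace ℂ E]

/-- The operator `D G†G + S ι†ι + α γ†γ` on a Hilbert space normed by `(G, ι)` is self-adjoint and
invertible. -/
theorem exists_unit_inner_eq [CompleteSpace E] {X Y Z : Type*}
    [NormedAddCommGroup X] [InnerProductSpace ℂ X] [CompleteSpace X]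
    [NormedAddCommGroup Y] [InnerProductSpace ℂ Y] [CompleteSpace Y]
    [NormedAddCommGroup Z] [InnerProductSpace ℂ Z] [CompleteSpace Z]
    (G : E →L[ℂ] X) (ι : E →L[ℂ] Y) (γ : E →L[ℂ] Z) (hnorm : ∀ u, ‖u‖ ^ 2 = ‖ι u‖ ^ 2 + ‖G u‖ ^ 2)
    {D S α : ℝ} (hD : 0 < D) (hS : 0 < S) (hα : 0 ≤ α) :
    ∃ A : (E →L[ℂ] E)ˣ, ∀ u v : E,
      ⟪v, (A : E →L[ℂ] E) u⟫_ℂ = D * ⟪G v, G u⟫_ℂ + S * ⟪ι v, ι u⟫_ℂ + α * ⟪γ v, γ u⟫_ℂ ∧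
      ⟪(A : E →L[ℂ] E) v, u⟫_ℂ = D * ⟪G v, G u⟫_ℂ + S * ⟪ι v, ι u⟫_ℂ + α * ⟪γ v, γ u⟫_ℂ := by
  let A : E →L[ℂ] E :=
    (D : ℂ) • (ContinuousLinearMap.adjoint G).comp G +
      (S : ℂ) • (ContinuousLinearMap.adjoint ι).comp ι +
      (α : ℂ) • (ContinuousLinearMap.adjoint γ).comp γ
  have hA : ∀ u, A u = (D : ℂ) • ContinuousLinearMap.adjoint G (G u) +
      (S : ℂ) • ContinuousLinearMap.adjoint ι (ι u) +
      (α : ℂ) • ContinuousLinearMap.adjoint γ (γ u) := fun u => rfl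
  have hr : ∀ u v : E,
      ⟪v, A u⟫_ℂ = D * ⟪G v, G u⟫_ℂ + S * ⟪ι v, ι u⟫_ℂ + α * ⟪γ v, γ u⟫_ℂ := fun u v => by
    simp only [hA, inner_add_right, inner_smul_right, ContinuousLinearMap.adjoint_inner_right]
  have hl : ∀ u v : E,
      ⟪A v, u⟫_ℂ = D * ⟪G v, G u⟫_ℂ + S * ⟪ι v, ι u⟫_ℂ + α * ⟪γ v, γ u⟫_ℂ := fun u v => by
    simp only [hA, inner_add_left, inner_smul_left, ContinuousLinearMap.adjoint_inner_left,
      Complex.conj_ofReal]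
  have hc : 0 < min D S := lt_min hD hS
  -- Lax-Milgram: `⟪A u, u⟫` is real and at least `min D S * ‖u‖²`, the term with `γ` being
  -- nonnegative.
  have hunit : IsUnit A := by
    refine ContinuousLinearMap.isUnit_of_forall_le_norm_inner_map A (c := ⟨min D S, hc.le⟩) hc
      fun u => ?_
    have e : ⟪A u, u⟫_ℂ = ((D * ‖G u‖ ^ 2 + S * ‖ι u‖ ^ 2 + α * ‖γ u‖ ^ 2 : ℝ) : ℂ) := by
      rw [hl, inner_self_eq_norm_sq_to_K, inner_self_eq_norm_sq_to_K, inner_self_eq_norm_sq_to_K]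
      push_cast
      rfl
    rw [e, Complex.norm_real, hnorm]
    refine le_trans ?_ (le_abs_self _)
    change (‖ι u‖ ^ 2 + ‖G u‖ ^ 2) * min D S ≤ _
    have h1 := mul_le_mul_of_nonneg_left (min_le_left D S) (sq_nonneg ‖G u‖)
    have h2 := mul_le_mul_of_nonneg_left (min_le_right D S) (sq_nonneg ‖ι u‖)
    have h3 : 0 ≤ α * ‖γ u‖ ^ 2 := by positivity
    linarith
  obtain ⟨B, hB⟩ := hunit
  exact ⟨B, fun u v => by rw [hB]; exact ⟨hr u v, hl u v⟩⟩

theorem unit_apply_eq_iff (A : (E →L[ℂ] E)ˣ) (x y : E) :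
    (A : E →L[ℂ] E) x = y ↔ x = (↑A⁻¹ : E →L[ℂ] E) y := by
  constructor
  · rintro rfl
    rw [← mul_apply_eq_comp, Units.inv_mul, one_apply_eq_self]
  · rintro rfl
    rw [← mul_apply_eq_comp, Units.mul_inv, one_apply_eq_self]

theorem forall_inner_add_inner_eq_iff_right (a b a' b' : E) :
    (∀ v : WithLp 2 (E × E), ⟪v.fst, a⟫_ℂ + ⟪v.snd, b⟫_ℂ = ⟪v.fst, a'⟫_ℂ + ⟪v.snd, b'⟫_ℂ) ↔
      a = a' ∧ b = b' := by
  refine ⟨fun h => ⟨ext_inner_left ℂ fun v => ?_, ext_inner_left ℂ fun v => ?_⟩, ?_⟩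
  · simpa using h (WithLp.toLp 2 (v, 0))
  · simpa using h (WithLp.toLp 2 (0, v))
  · rintro ⟨rfl, rfl⟩ v
    rfl

theorem forall_inner_add_inner_eq_iff_left (a b a' b' : E) :
    (∀ v : WithLp 2 (E × E), ⟪a, v.fst⟫_ℂ + ⟪b, v.snd⟫_ℂ = ⟪a', v.fst⟫_ℂ + ⟪b', v.snd⟫_ℂ) ↔
      a = a' ∧ b = b' := by
  refine ⟨fun h => ⟨ext_inner_right ℂ fun v => ?_, ext_inner_right ℂ fun v => ?_⟩, ?_⟩
  · simpa using h (WithLp.toLp 2 (v, 0))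
  · simpa using h (WithLp.toLp 2 (0, v))
  · rintro ⟨rfl, rfl⟩ v
    rfl

/-- The pair of two operators with values in `E`. -/
noncomputable def pairOp {G : Type*} [NormedAddCommGroup G] [NormedSpace ℂ G] (K₁ K₂ : G →L[ℂ] E) :
    G →L[ℂ] WithLp 2 (E × E) :=
  ((WithLp.prodContinuousLinearEquiv 2 ℂ E E).symm : E × E →L[ℂ] WithLp 2 (E × E)).comp
    (K₁.prod K₂)

theorem eq_pairOp_iff {G : Type*} [NormedAddCommGroup G] [NormedSpace ℂ G] (K₁ K₂ : G →L[ℂ] E)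
    (x : G) (Φ : WithLp 2 (E × E)) : Φ = pairOp K₁ K₂ x ↔ Φ.fst = K₁ x ∧ Φ.snd = K₂ x := by
  constructor
  · rintro rfl
    exact ⟨rfl, rfl⟩
  · rintro ⟨h1, h2⟩
    exact WithLp.ofLp_injective 2 (Prod.ext h1 h2)

theorem isCompactOperator_pairOp {G : Type*} [NormedAddCommGroup G] [NormedSpace ℂ G]
    {K₁ K₂ : G →L[ℂ] E} (h₁ : IsCompactOperator K₁) (h₂ : IsCompactOperator K₂) :
    IsCompactOperator (pairOp K₁ K₂) := by
  let J : E × E →L[ℂ] WithLp 2 (E × E) := (WithLp.prodContinuousLinearEquiv 2 ℂ E E).symm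
  have h := (h₁.clm_comp (J.comp (ContinuousLinearMap.inl ℂ E E))).add
    (h₂.clm_comp (J.comp (ContinuousLinearMap.inr ℂ E E)))
  refine (congrArg IsCompactOperator (funext fun x => ?_)).mp h
  change J (K₁ x, 0) + J (0, K₂ x) = J (K₁ x, K₂ x)
  rw [← map_add]
  simp

/-- Solution operator of a lower triangular system. -/
theorem exists_triangular_solutionOp (A₁ A₂ : (E →L[ℂ] E)ˣ) {M : E →L[ℂ] E}
    (hM : IsCompactOperator M) (c₁ c₂ s : ℂ) :
    ∃ T : WithLp 2 (E × E) →L[ℂ] WithLp 2 (E × E),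
      (∀ F Φ : WithLp 2 (E × E), (∀ v : WithLp 2 (E × E),
        ⟪v.fst, (A₁ : E →L[ℂ] E) Φ.fst⟫_ℂ +
          (⟪v.snd, (A₂ : E →L[ℂ] E) Φ.snd⟫_ℂ - s * ⟪v.snd, M Φ.fst⟫_ℂ) =
        c₁ * ⟪v.fst, M F.fst⟫_ℂ + c₂ * ⟪v.fst, M F.snd⟫_ℂ) ↔ Φ = T F) ∧ IsCompactOperator T := by
  let B : WithLp 2 (E × E) →L[ℂ] E := c₁ • M.comp (WithLp.fstL 2 ℂ E E) +
    c₂ • M.comp (WithLp.sndL 2 ℂ E E)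
  -- Forward substitution: the first equation involves `Φ.fst` alone, and its solution feeds the
  -- second. Each component contains a factor `M`, whence compactness.
  let K₁ : WithLp 2 (E × E) →L[ℂ] E := (↑A₁⁻¹ : E →L[ℂ] E).comp B
  let K₂ : WithLp 2 (E × E) →L[ℂ] E := (↑A₂⁻¹ : E →L[ℂ] E).comp (s • M.comp K₁)
  have hB : IsCompactOperator B := ((hM.comp_clm (WithLp.fstL 2 ℂ E E)).smul c₁).add
    ((hM.comp_clm (WithLp.sndL 2 ℂ E E)).smul c₂)
  refine ⟨pairOp K₁ K₂, fun F Φ => ?_, isCompactOperator_pairOp (hB.clm_comp _)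
    (((hM.comp_clm K₁).smul s).clm_comp _)⟩
  have hb : B F = c₁ • M F.fst + c₂ • M F.snd := rfl
  have h : ∀ v : WithLp 2 (E × E), (⟪v.fst, (A₁ : E →L[ℂ] E) Φ.fst⟫_ℂ +
        (⟪v.snd, (A₂ : E →L[ℂ] E) Φ.snd⟫_ℂ - s * ⟪v.snd, M Φ.fst⟫_ℂ) =
        c₁ * ⟪v.fst, M F.fst⟫_ℂ + c₂ * ⟪v.fst, M F.snd⟫_ℂ) ↔
      ⟪v.fst, (A₁ : E →L[ℂ] E) Φ.fst⟫_ℂ + ⟪v.snd, (A₂ : E →L[ℂ] E) Φ.snd - s • M Φ.fst⟫_ℂ =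
        ⟪v.fst, B F⟫_ℂ + ⟪v.snd, 0⟫_ℂ := fun v => by
    rw [hb, inner_add_right, inner_smul_right, inner_smul_right, inner_sub_right, inner_smul_right,
      inner_zero_right, add_zero]
  simp only [h]
  rw [forall_inner_add_inner_eq_iff_right, eq_pairOp_iff, unit_apply_eq_iff, sub_eq_zero,
    unit_apply_eq_iff]
  refine and_congr_right fun h => ?_
  rw [h]
  rfl

/-- Solution operator of the adjoint, upper triangular system. -/
theorem exists_triangular_adjointSolutionOp (A₁ A₂ : (E →L[ℂ] E)ˣ) {M : E →L[ℂ] E}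
    (hM : IsCompactOperator M) (c₁ c₂ s : ℝ) :
    ∃ T : WithLp 2 (E × E) →L[ℂ] WithLp 2 (E × E),
      (∀ F Φ : WithLp 2 (E × E), (∀ v : WithLp 2 (E × E),
        ⟪(A₁ : E →L[ℂ] E) Φ.fst, v.fst⟫_ℂ +
          (⟪(A₂ : E →L[ℂ] E) Φ.snd, v.snd⟫_ℂ - s * ⟪M Φ.snd, v.fst⟫_ℂ) =
        c₁ * ⟪M F.fst, v.fst⟫_ℂ + c₂ * ⟪M F.fst, v.snd⟫_ℂ) ↔ Φ = T F) ∧ IsCompactOperator T := by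
  let B₁ : WithLp 2 (E × E) →L[ℂ] E := (c₁ : ℂ) • M.comp (WithLp.fstL 2 ℂ E E)
  let B₂ : WithLp 2 (E × E) →L[ℂ] E := (c₂ : ℂ) • M.comp (WithLp.fstL 2 ℂ E E)
  -- Passing to the adjoint reverses the coupling, so the second component is found first. The
  -- coefficients are real and therefore survive conjugation.
  let K₂ : WithLp 2 (E × E) →L[ℂ] E := (↑A₂⁻¹ : E →L[ℂ] E).comp B₂
  let K₁ : WithLp 2 (E × E) →L[ℂ] E := (↑A₁⁻¹ : E →L[ℂ] E).comp (B₁ + (s : ℂ) • M.comp K₂)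
  have hB₁ : IsCompactOperator B₁ := (hM.comp_clm (WithLp.fstL 2 ℂ E E)).smul (c₁ : ℂ)
  have hB₂ : IsCompactOperator B₂ := (hM.comp_clm (WithLp.fstL 2 ℂ E E)).smul (c₂ : ℂ)
  refine ⟨pairOp K₁ K₂, fun F Φ => ?_, isCompactOperator_pairOp
    ((hB₁.add ((hM.comp_clm K₂).smul (s : ℂ))).clm_comp _) (hB₂.clm_comp _)⟩
  have hb₁ : B₁ F = (c₁ : ℂ) • M F.fst := rfl
  have hb₂ : B₂ F = (c₂ : ℂ) • M F.fst := rfl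
  have h : ∀ v : WithLp 2 (E × E), (⟪(A₁ : E →L[ℂ] E) Φ.fst, v.fst⟫_ℂ +
        (⟪(A₂ : E →L[ℂ] E) Φ.snd, v.snd⟫_ℂ - s * ⟪M Φ.snd, v.fst⟫_ℂ) =
        c₁ * ⟪M F.fst, v.fst⟫_ℂ + c₂ * ⟪M F.fst, v.snd⟫_ℂ) ↔
      ⟪(A₁ : E →L[ℂ] E) Φ.fst - (s : ℂ) • M Φ.snd, v.fst⟫_ℂ + ⟪(A₂ : E →L[ℂ] E) Φ.snd, v.snd⟫_ℂ =
        ⟪B₁ F, v.fst⟫_ℂ + ⟪B₂ F, v.snd⟫_ℂ := fun v => by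
    rw [hb₁, hb₂, inner_smul_left, inner_smul_left, inner_sub_left, inner_smul_left,
      Complex.conj_ofReal, Complex.conj_ofReal, Complex.conj_ofReal, sub_add_eq_add_sub,
      add_sub_assoc]
  simp only [h]
  rw [forall_inner_add_inner_eq_iff_left, eq_pairOp_iff, unit_apply_eq_iff, sub_eq_iff_eq_add,
    unit_apply_eq_iff]
  refine and_congr_left fun h => ?_
  rw [h]
  rfl

end Hilbert

/-! ### The forms as inner products -/

section Forms

variable {d : ℕ} {Ω : Set (Space d)}

/-- The arguments are exchanged because `⟪·, ·⟫_ℂ` is conjugate-linear in its first slot, the forms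
in their second. -/
theorem massForm_eq_inner (u v : H1 Ω) : massForm u v = ⟪valL Ω v, valL Ω u⟫_ℂ := by
  rw [L2.inner_def, massForm]
  rfl

theorem gradForm_eq_inner (u v : H1 Ω) : gradForm u v = ⟪gradL Ω v, gradL Ω u⟫_ℂ := by
  rw [L2.inner_def, gradForm]
  refine integral_congr_ae (Eventually.of_forall fun x => ?_)
  simp only [coe_gradL, PiLp.inner_apply]
  rfl

theorem bdryForm_eq_inner {γ : H1 Ω →L[ℂ] Lp ℂ 2 (surf Ω)} (hγ : ∀ u, γ u = trace u)
    (u v : H1 Ω) : bdryForm u v = ⟪γ v, γ u⟫_ℂ := by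
  rw [L2.inner_def, bdryForm, hγ, hγ]
  rfl

/-- The operator representing the `L²` inner product on `H¹(Ω)`. -/
noncomputable def massOp (Ω : Set (Space d)) : H1 Ω →L[ℂ] H1 Ω :=
  (ContinuousLinearMap.adjoint (valL Ω)).comp (valL Ω)

theorem inner_massOp_right (u v : H1 Ω) : ⟪v, massOp Ω u⟫_ℂ = massForm u v := by
  rw [massOp, ContinuousLinearMap.comp_apply, ContinuousLinearMap.adjoint_inner_right,
    massForm_eq_inner]

theorem inner_massOp_left (u v : H1 Ω) : ⟪massOp Ω v, u⟫_ℂ = massForm u v := by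
  rw [massOp, ContinuousLinearMap.comp_apply, ContinuousLinearMap.adjoint_inner_left,
    massForm_eq_inner]

theorem IsBoundedLipschitzDomain.isCompactOperator_massOp (hΩ : IsBoundedLipschitzDomain Ω) :
    IsCompactOperator (massOp Ω) :=
  hΩ.isCompactOperator_valL.clm_comp (ContinuousLinearMap.adjoint (valL Ω))

/-- The form of the Robin problem `-D Δu + S u` with boundary coefficient `α`. -/
noncomputable def robinForm (D S α : ℝ) (u v : H1 Ω) : ℂ :=
  D * gradForm u v + S * massForm u v + α * bdryForm u v

set_option maxHeartbeats 2000000 in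
/-- The Robin form is represented by an invertible self-adjoint operator. -/
theorem IsBoundedLipschitzDomain.exists_robinOp (hΩ : IsBoundedLipschitzDomain Ω) {D S α : ℝ}
    (hD : 0 < D) (hS : 0 < S) (hα : 0 ≤ α) :
    ∃ A : (H1 Ω →L[ℂ] H1 Ω)ˣ, ∀ u v : H1 Ω,
      ⟪v, (A : H1 Ω →L[ℂ] H1 Ω) u⟫_ℂ = robinForm D S α u v ∧
      ⟪(A : H1 Ω →L[ℂ] H1 Ω) v, u⟫_ℂ = robinForm D S α u v := by
  obtain ⟨γ, hγ⟩ := hΩ.exists_traceL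
  obtain ⟨A, hA⟩ := exists_unit_inner_eq (gradL Ω) (valL Ω) γ norm_sq_eq hD hS hα
  refine ⟨A, fun u v => ?_⟩
  rw [robinForm, gradForm_eq_inner, massForm_eq_inner, bdryForm_eq_inner hγ]
  exact hA u v

end Forms

/-! ### The two solution operators -/

section Solution

variable {d : ℕ} {Ω : Set (Space d)} {P : Coefficients}

set_option maxHeartbeats 2000000 in
-- Exhibits the triangular structure: two Robin forms coupled by a single mass term, with the
-- removal coefficient `Sa1 + S12` in group 1.
theorem formA_eq (P : Coefficients) (Φ v : V Ω) :
    formA P Φ v = robinForm P.D₁ (P.Sa1 + P.S12) P.α₁ Φ.fst v.fst +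
      (robinForm P.D₂ P.Sa2 P.α₂ Φ.snd v.snd - P.S12 * massForm Φ.fst v.snd) := by
  simp only [formA, robinForm]
  push_cast
  ring

set_option maxHeartbeats 2000000 in
-- The equivalence with `Φ = T F` contains existence and uniqueness at once.
theorem IsBoundedLipschitzDomain.exists_solutionOp (hΩ : IsBoundedLipschitzDomain Ω)
    (hD₁ : 0 < P.D₁) (hD₂ : 0 < P.D₂) (hSa1 : 0 < P.Sa1) (hSa2 : 0 < P.Sa2) (hS12 : 0 < P.S12)
    (hα₁ : 0 ≤ P.α₁) (hα₂ : 0 ≤ P.α₂) :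
    ∃ T : V Ω →L[ℂ] V Ω, (∀ F Φ, IsSourceSolution P F Φ ↔ Φ = T F) ∧ IsCompactOperator T := by
  obtain ⟨A₁, h₁⟩ := hΩ.exists_robinOp hD₁ (add_pos hSa1 hS12) hα₁
  obtain ⟨A₂, h₂⟩ := hΩ.exists_robinOp hD₂ hSa2 hα₂
  obtain ⟨T, hT, hTc⟩ := exists_triangular_solutionOp A₁ A₂ hΩ.isCompactOperator_massOp
    (P.ν₁ * P.Sf1) (P.ν₂ * P.Sf2) P.S12
  refine ⟨T, fun F Φ => ?_, hTc⟩
  rw [← hT F Φ]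
  refine forall_congr' fun v => ?_
  rw [formA_eq, formB, (h₁ _ _).1, (h₂ _ _).1, inner_massOp_right, inner_massOp_right,
    inner_massOp_right]

set_option maxHeartbeats 2000000 in
theorem IsBoundedLipschitzDomain.exists_adjointSolutionOp (hΩ : IsBoundedLipschitzDomain Ω)
    (hD₁ : 0 < P.D₁) (hD₂ : 0 < P.D₂) (hSa1 : 0 < P.Sa1) (hSa2 : 0 < P.Sa2) (hS12 : 0 < P.S12)
    (hα₁ : 0 ≤ P.α₁) (hα₂ : 0 ≤ P.α₂) :
    ∃ T : V Ω →L[ℂ] V Ω, (∀ F Φ, IsAdjointSourceSolution P F Φ ↔ Φ = T F) ∧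
      IsCompactOperator T := by
  obtain ⟨A₁, h₁⟩ := hΩ.exists_robinOp hD₁ (add_pos hSa1 hS12) hα₁
  obtain ⟨A₂, h₂⟩ := hΩ.exists_robinOp hD₂ hSa2 hα₂
  obtain ⟨T, hT, hTc⟩ := exists_triangular_adjointSolutionOp A₁ A₂ hΩ.isCompactOperator_massOp
    (P.ν₁ * P.Sf1) (P.ν₂ * P.Sf2) P.S12
  refine ⟨T, fun F Φ => ?_, hTc⟩
  rw [← hT F Φ]
  refine forall_congr' fun v => ?_
  rw [formA_eq, formB, (h₁ _ _).2, (h₂ _ _).2, inner_massOp_left, inner_massOp_left,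
    inner_massOp_left, Complex.ofReal_mul, Complex.ofReal_mul]

end Solution

end TwoGroup

set_option maxHeartbeats 2000000 in
theorem mainTheorem4 {d : ℕ} (hd : d = 2 ∨ d = 3) (Ω : Set (TwoGroup.Space d))
    (hΩ : TwoGroup.IsBoundedLipschitzDomain Ω) (P : TwoGroup.Coefficients)
    (hD₁ : 0 < P.D₁) (hD₂ : 0 < P.D₂) (hSa1 : 0 < P.Sa1) (hSa2 : 0 < P.Sa2) (hS12 : 0 < P.S12)
    (hα₁ : 0 ≤ P.α₁) (hα₂ : 0 ≤ P.α₂) :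
    (∀ u : TwoGroup.H1 Ω, ∃! γ, TwoGroup.IsTrace u γ) ∧
    (∀ F : TwoGroup.V Ω, ∃! Φ : TwoGroup.V Ω, TwoGroup.IsSourceSolution P F Φ) ∧
    (∃ T : TwoGroup.V Ω →L[ℂ] TwoGroup.V Ω,
      (∀ F, TwoGroup.IsSourceSolution P F (T F)) ∧ IsCompactOperator T) ∧
    (∀ F : TwoGroup.V Ω, ∃! Φ : TwoGroup.V Ω, TwoGroup.IsAdjointSourceSolution P F Φ) ∧
    (∃ Tstar : TwoGroup.V Ω →L[ℂ] TwoGroup.V Ω,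
      (∀ F, TwoGroup.IsAdjointSourceSolution P F (Tstar F)) ∧ IsCompactOperator Tstar) := by
  obtain ⟨T, hT, hTc⟩ := hΩ.exists_solutionOp hD₁ hD₂ hSa1 hSa2 hS12 hα₁ hα₂
  obtain ⟨S, hS, hSc⟩ := hΩ.exists_adjointSolutionOp hD₁ hD₂ hSa1 hSa2 hS12 hα₁ hα₂
  exact ⟨hΩ.existsUnique_isTrace,
    fun F => ⟨T F, (hT F _).2 rfl, fun Φ h => (hT F Φ).1 h⟩,
    ⟨T, fun F => (hT F _).2 rfl, hTc⟩,
    fun F => ⟨S F, (hS F _).2 rfl, fun Φ h => (hS F Φ).1 h⟩,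
    ⟨S, fun F => (hS F _).2 rfl, hSc⟩⟩
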